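/- Let $n\ge 1$ be an integer and $\beta>0$. Write $\Delta(x)=\prod_{1\le i<j\le n}(x_i-x_j)$ for $x\in\mathbb R^n$. For $k>0$ let $\chi_k$ denote the chi distribution with $k$ degrees of freedom, i.e. the law on $(0,\infty)$ with density $\frac{2^{1-k/2}}{\Gamma(k/2)}\,x^{k-1}e^{-x^2/2}$. Let $\mathcal N_1,\dots,\mathcal N_n$ and $\xi_1,\dots,\xi_{n-1}$ be independent random variables, where each $\mathcal N_i$ is standard Gaussian and $\xi_i$ has law $\chi_{(n-i)\beta}$, and let $T_\beta$ be the random symmetric tridiagonal $n\times n$ matrix with diagonal entries $\mathcal N_1,\dots,\mathcal N_n$ and off-diagonal entries $(T_\beta)_{i,i+1}=(T_\beta)_{i+1,i}=\xi_i/\sqrt2$ (equivalently, the squares of the off-diagonal entries are Gamma distributed with shape $\tfrac12(n-i)\beta$ and scale $1$). Almost surely write $T_\beta=Q\Lambda Q^{\mathsf T}$ with $Q$ orthogonal and $\Lambda=\operatorname{diag}(\Lambda_1,\dots,\Lambda_n)$, $\Lambda_1\ge\dots\ge\Lambda_n$, and let $w_k=Q_{1k}^2$ be the squared first coordinate of the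 $k$-th normalized eigenvector. Then: 1. The spectrum of $T_\beta$, as an unordered configuration of $n$ points, is the Gaussian $\beta$-ensemble, i.e. the probability law $$\frac1{Z_n^\beta}\,|\Delta(x)|^\beta e^{-\frac12\sum_{i=1}^n x_i^2}\,dx_1\cdots dx_n,\qquad Z_n^\beta=\int_{\mathbb R^n}|\Delta(x)|^\beta e^{-\frac12\sum_{i=1}^n x_i^2}\,dx ,$$ in the sense that $\mathbb P((\Lambda_1,\dots,\Lambda_n)\in A)$ equals the measure of $A$ under this law for every permutation-invariant Borel set $A\subseteq\mathbb R^n$. Accordingly, the ordered vector $(\Lambda_1,\dots,\Lambda_n)$ has density $\frac{n!}{Z_n^\beta}|\Delta(x)|^\beta e^{-\frac12\sum_i x_i^2}$ on $\{x_1>x_2>\dots>x_n\}$. 2. The vector $(w_1,\dots,w_n)$ is independent of $(\Lambda_1,\dots,\Lambda_n)$ and has the Dirichlet distribution with parameters $(\tfrac\beta2,\dots,\tfrac\beta2)$, i.e. density $\frac{\Gamma(n\beta/2)}{\Gamma(\beta/2)^n}\prod_{k=1}^n w_k^{\beta/2-1}$ on the open simplex $\{w_k>0,\ \sum_k w_k=1\}$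 with respect to $dw_1\cdots dw_{n-1}$. 3. (Macdonald–Mehta–Opdam formula) The integral $Z_n^\beta$ converges and $$Z_n^\beta=(2\pi)^{n/2}\prod_{j=1}^n\frac{\Gamma\left(1+\frac\beta2 j\right)}{\Gamma\left(1+\frac\beta2\right)} .$$ -/

import Mathlib

open MeasureTheory ProbabilityTheory

noncomputable section

namespace BetaEnsemble

/-- The chi distribution with `k > 0` (real) degrees of freedom: the law on the positive half-line
with density `2 ^ (1 - k / 2) / Γ(k / 2) * x ^ (k - 1) * exp (-x ^ 2 / 2)`. -/
def chiMeasure (k : ℝ) : Measure ℝ :=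
  volume.withDensity fun x => ENNReal.ofReal
    (if 0 < x then
      (2 : ℝ) ^ (1 - k / 2) / Real.Gamma (k / 2) * x ^ (k - 1) * Real.exp (-x ^ 2 / 2)
    else 0)

/-- The symmetric tridiagonal (Jacobi) matrix with diagonal `a` and off-diagonal `b`. -/
def jacobiMatrix {n : ℕ} (a : Fin n → ℝ) (b : Fin (n - 1) → ℝ) : Matrix (Fin n) (Fin n) ℝ :=
  fun i j =>
    if i = j then a i
    else if h : i.val + 1 = j.val then b ⟨i.val, by omega⟩
    else if h : j.val + 1 = i.val then b ⟨j.val, by omega⟩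
    else 0

/-- The Vandermonde product of `x i - x j` over all pairs `i < j`. -/
def vandermondeProd {n : ℕ} (x : Fin n → ℝ) : ℝ :=
  ∏ i : Fin n, ∏ j ∈ Finset.Ioi i, (x i - x j)

/-- The unnormalized density of the Gaussian beta-ensemble with `n` points. -/
def gbeWeight (n : ℕ) (β : ℝ) (x : Fin n → ℝ) : ℝ :=
  |vandermondeProd x| ^ β * Real.exp (-(1 / 2) * ∑ i, x i ^ 2)

/-- The normalization constant of the Gaussian beta-ensemble. -/
def gbeConst (n : ℕ) (β : ℝ) : ℝ :=
  ∫ x : Fin n → ℝ, gbeWeight n β x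

/-- The Gaussian beta-ensemble, as a (permutation invariant) law on `ℝⁿ`. -/
def gbe (n : ℕ) (β : ℝ) : Measure (Fin n → ℝ) :=
  volume.withDensity fun x => ENNReal.ofReal (gbeWeight n β x / gbeConst n β)

/-- The law of the decreasingly ordered points of the Gaussian beta-ensemble:
density `n! / Z * |Δ(x)| ^ β * exp (-|x|² / 2)` on the chamber `x₁ > x₂ > ⋯ > xₙ`. -/
def orderedGbe (n : ℕ) (β : ℝ) : Measure (Fin n → ℝ) :=
  (n.factorial : ENNReal) • (gbe n β).restrict {x | StrictAnti x}

/-- The point of the hyperplane `∑ i, w i = 1` of `ℝⁿ` (`n ≥ 1`) whose first `n - 1` coordinates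
are given by `x`. -/
def simplexPoint (n : ℕ) (x : Fin (n - 1) → ℝ) : Fin n → ℝ :=
  fun i => if h : i.val < n - 1 then x ⟨i.val, h⟩ else 1 - ∑ j, x j

/-- The Dirichlet distribution on the simplex of `ℝⁿ` (`n ≥ 1`) with positive parameters `α`:
density `Γ(∑ α i) / ∏ Γ(α i) * ∏ w i ^ (α i - 1)` on the open simplex, with respect to
Lebesgue measure in the first `n - 1` coordinates. -/
def dirichletMeasure {n : ℕ} (α : Fin n → ℝ) : Measure (Fin n → ℝ) :=
  (volume.withDensity fun x : Fin (n - 1) → ℝ => ENNReal.ofReal (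
    open scoped Classical in
    if ∀ i, 0 < simplexPoint n x i then
      Real.Gamma (∑ i, α i) / (∏ i, Real.Gamma (α i)) * ∏ i, simplexPoint n x i ^ (α i - 1)
    else 0)).map (simplexPoint n)

/-- `Q` and `l` diagonalize the real symmetric matrix `T`: `Q` is orthogonal, its `k`-th column is
an eigenvector for the eigenvalue `l k`, and the eigenvalues are listed in decreasing order. -/
def IsOrderedDiagonalization {n : ℕ} (T Q : Matrix (Fin n) (Fin n) ℝ) (l : Fin n → ℝ) : Prop :=
  Antitone l ∧ Q ∈ Matrix.orthogonalGroup (Fin n) ℝ ∧ T = Q * Matrix.diagonal l * Q.transpose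

end BetaEnsemble

end

open BetaEnsemble

noncomputable section

namespace BetaEnsemble

open Finset Matrix

/-! ### Determinants of Vandermonde type -/

/-! Write `n = m + 1`. A Jacobi matrix has `2 m + 1` parameters, and so does a probability measure
with `n` atoms: `n` positions and `m` free weights. The two are linked by the spectral measure of
the matrix at the first basis vector, whose moments of order `1, …, 2 m + 1` are polynomials in
either set of coordinates. Both moment maps are differentiated and their Jacobians compared;
eigenvalues themselves are never differentiated.

In atoms and weights the Jacobian is a confluent Vandermonde determinant, of absolute value `∏ w *
|Δ| ^ 4` (`abs_det_atomicJacobian`). In the matrix entries the moment map is triangular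
(`jacobiMoment_sub_congr`), with an explicit determinant (`det_jacobiJacobian_mul`). Both maps are
injective and have the same image: the spectral theorem gives one inclusion, Gram–Schmidt on the
monomials (the Lanczos procedure) the other (`image_atomicMoment_eq`).

The determinant of the Krylov matrix expresses the off-diagonal entries through `∏ w * Δ ^ 2`
(`prod_offProd_sq`), and the trace of the square turns the Gaussian exponent into the sum of the
squared eigenvalues (`sum_sq_eq`). Inserted in the joint density of the entries, these identities
leave a function of the eigenvalues times the Dirichlet density of the weights (`density_relation`),
hence independence.

The Dirichlet constant comes from slicing a product of Gamma densities (`lintegral_simplexWeight`).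
As the joint law has mass one, the eigenvalue factor has mass one too
(`isProbabilityMeasure_chamberDensity`); summing over the `n!` orderings then evaluates the
Macdonald–Mehta integral with no further integration. -/

theorem vandermondeProd_sq_eq_det {n : ℕ} (x : Fin n → ℝ) :
    |vandermondeProd x| = |(Matrix.vandermonde x).det| := by
  rw [Matrix.det_vandermonde, vandermondeProd, abs_prod, abs_prod]
  refine prod_congr rfl fun i _ => ?_
  rw [abs_prod, abs_prod]
  exact prod_congr rfl fun j _ => abs_sub_comm _ _

/-- The square of a Vandermonde product, as a product over off-diagonal pairs. -/
theorem prod_prod_Ioi_sq {n : ℕ} (x : Fin n → ℝ) :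
    (∏ i, ∏ j ∈ Ioi i, |x j - x i|) ^ 2 = ∏ i, ∏ j ∈ univ.erase i, |x i - x j| := by
  have h1 : ∀ i : Fin n, univ.erase i = Ioi i ∪ Iio i := by
    intro i; ext j; simp only [mem_erase, mem_univ, and_true, mem_union, mem_Ioi, mem_Iio]
    rw [ne_iff_lt_or_gt, or_comm]
  have h2 : ∀ i : Fin n, Disjoint (Ioi i) (Iio i) := by
    intro i; rw [disjoint_left]; intro j; simp only [mem_Ioi, mem_Iio]; exact fun h => not_lt.2 h.le
  simp_rw [h1, prod_union (h2 _)]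
  rw [prod_mul_distrib, sq]
  congr 1
  · exact prod_congr rfl fun i _ => prod_congr rfl fun j _ => abs_sub_comm _ _
  · rw [prod_comm' (t' := univ) (s' := fun j => Iio j)]
    intro i j; simp

/-- Squaring removes the order on the indices: every ordered pair appears once, so the formula
transfers to any finite index type. -/
theorem abs_det_vandermonde_sq {n : ℕ} (x : Fin n → ℝ) :
    |(Matrix.vandermonde x).det| ^ 2 = ∏ i, ∏ j ∈ univ.erase i, |x i - x j| := by
  rw [← prod_prod_Ioi_sq, Matrix.det_vandermonde, abs_prod]
  simp_rw [abs_prod]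

/-- Squared generalized Vandermonde determinant, for arbitrary index types and an enumeration of the
exponents `0, …, N - 1`. -/
theorem abs_det_pow_sq {κ : Type*} [Fintype κ] [DecidableEq κ] {N : ℕ} (hN : Fintype.card κ = N)
    (e : κ → ℕ) (he : Function.Injective e) (hlt : ∀ k, e k < N) (x : κ → ℝ) :
    |(Matrix.of fun j i => x i ^ e j : Matrix κ κ ℝ).det| ^ 2
      = ∏ i, ∏ j ∈ univ.erase i, |x i - x j| := by
  have hbij : Function.Bijective (fun k => (⟨e k, hlt k⟩ : Fin N)) := by
    rw [Fintype.bijective_iff_injective_and_card]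
    exact ⟨fun a b h => he (by simpa using h), by simp [hN]⟩
  let σ : κ ≃ Fin N := Equiv.ofBijective _ hbij
  have h1 : (Matrix.of fun j i => x i ^ e j : Matrix κ κ ℝ)
      = ((Matrix.vandermonde (x ∘ σ.symm)).transpose).submatrix σ σ := by
    ext j i
    simp [Matrix.vandermonde_apply, σ]
  rw [h1, Matrix.det_submatrix_equiv_self, Matrix.det_transpose, abs_det_vandermonde_sq]
  refine Fintype.prod_equiv σ.symm _ _ fun i => ?_
  refine prod_nbij' σ.symm σ ?_ ?_ ?_ ?_ ?_ <;> simp [Equiv.eq_symm_apply]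

/-- The confluent Vandermonde determinant: values and derivatives of the monomials of degree less
than `2 n` at `n` points. -/
theorem abs_det_confluent {n : ℕ} (e : Fin n ⊕ Fin n → ℕ) (he : Function.Injective e)
    (hlt : ∀ k, e k < 2 * n) (x : Fin n → ℝ) :
    |(Matrix.of fun j i => Sum.elim (fun i => e j * x i ^ (e j - 1)) (fun i => x i ^ e j) i :
      Matrix (Fin n ⊕ Fin n) (Fin n ⊕ Fin n) ℝ).det| = |vandermondeProd x| ^ 4 := by
  set C : Matrix (Fin n ⊕ Fin n) (Fin n ⊕ Fin n) ℝ :=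
    Matrix.of fun j i => Sum.elim (fun i => e j * x i ^ (e j - 1)) (fun i => x i ^ e j) i with hC
  let V : ℝ → Matrix (Fin n ⊕ Fin n) (Fin n ⊕ Fin n) ℝ :=
    fun h => Matrix.of fun j i => Sum.elim (fun i => x i + h) x i ^ e j
  -- Derivative columns are replaced by difference quotients: up to column operations, `D h` is a
  -- Vandermonde matrix at the `2 n` points `x i + h` and `x i`.
  let D : ℝ → Matrix (Fin n ⊕ Fin n) (Fin n ⊕ Fin n) ℝ := fun h => Matrix.of fun j i =>
    Sum.elim (fun i => h⁻¹ * ((x i + h) ^ e j - x i ^ e j)) (fun i => x i ^ e j) i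
  have hDV : ∀ h, D h = V h * Matrix.fromBlocks (h⁻¹ • 1) 0 (-h⁻¹ • 1) 1 := by
    intro h
    ext j i
    rcases i with i | i <;>
      simp [D, V, Matrix.mul_apply, Matrix.fromBlocks, Fintype.sum_sum_type, Matrix.one_apply]
    ring
  -- Each pair `x i + h`, `x i` contributes `|h| ^ 2` to the squared Vandermonde determinant,
  -- cancelling the squared determinant `h⁻¹ ^ (2 n)` of the column operations; what remains is
  -- continuous at `h = 0`.
  have hdet : ∀ h ≠ 0, |(D h).det| ^ 2 =
      ∏ i, ∏ j ∈ univ.erase i, (|x i - x j| ^ 2 * |x i - x j + h| * |x i - x j - h|) := by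
    intro h hh
    rw [hDV, Matrix.det_mul, Matrix.det_fromBlocks_zero₁₂, abs_mul, mul_pow,
      abs_det_pow_sq (N := 2 * n) (by simp [two_mul]) e he hlt]
    have e1 : ∀ i : Fin n, (univ : Finset (Fin n ⊕ Fin n)).erase (Sum.inl i)
        = (univ.erase i).disjSum univ := by
      intro i; ext j; rcases j with j | j <;> simp
    have e2 : ∀ i : Fin n, (univ : Finset (Fin n ⊕ Fin n)).erase (Sum.inr i)
        = univ.disjSum (univ.erase i) := by
      intro i; ext j; rcases j with j | j <;> simp
    rw [Fintype.prod_sum_type]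
    simp_rw [e1, e2, prod_disjSum]
    simp only [Sum.elim_inl, Sum.elim_inr, Matrix.det_smul, Matrix.det_one, mul_one,
      add_sub_add_right_eq_sub]
    have e3 : ∀ (f : Fin n → ℝ) (i : Fin n), ∏ j, f j = f i * ∏ j ∈ univ.erase i, f j :=
      fun f i => (mul_prod_erase _ _ (mem_univ i)).symm
    have e4 : ∀ i : Fin n, ∏ j, |x i + h - x j| = |h| * ∏ j ∈ univ.erase i, |x i - x j + h| := by
      intro i; rw [e3 _ i]; congr 1
      · congr 1; ring
      · refine prod_congr rfl fun j _ => ?_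
        congr 1; ring
    have e5 : ∀ i : Fin n, ∏ j, |x i - (x j + h)| = |h| * ∏ j ∈ univ.erase i, |x i - x j - h| := by
      intro i; rw [e3 _ i]; congr 1
      · rw [show x i - (x i + h) = -h by ring, abs_neg]
      · refine prod_congr rfl fun j _ => ?_
        congr 1; ring
    simp_rw [e4, e5, prod_mul_distrib, prod_const, Finset.prod_pow]
    simp only [card_univ, Fintype.card_fin, abs_pow, abs_inv, inv_pow]
    have : |h| ^ n ≠ 0 := pow_ne_zero _ (abs_ne_zero.2 hh)
    field_simp
  have hlim : Filter.Tendsto D (nhdsWithin 0 {0}ᶜ) (nhds C) := by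
    refine tendsto_pi_nhds.2 fun j => tendsto_pi_nhds.2 fun i => ?_
    rcases i with i | i
    · simp only [D, hC, Matrix.of_apply, Sum.elim_inl]
      have := (hasDerivAt_pow (e j) (x i)).tendsto_slope_zero
      simpa using this
    · simp only [D, hC, Matrix.of_apply, Sum.elim_inr]
      exact tendsto_const_nhds
  have hl1 : Filter.Tendsto (fun h => |(D h).det| ^ 2) (nhdsWithin 0 {0}ᶜ)
      (nhds (|C.det| ^ 2)) := by
    have hc : Continuous fun A : Matrix (Fin n ⊕ Fin n) (Fin n ⊕ Fin n) ℝ => |A.det| ^ 2 := by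
      fun_prop
    exact (hc.tendsto C).comp hlim
  have hl2 : Filter.Tendsto (fun h => |(D h).det| ^ 2) (nhdsWithin 0 {0}ᶜ)
      (nhds (∏ i, ∏ j ∈ univ.erase i, (|x i - x j| ^ 2 * |x i - x j + 0| * |x i - x j - 0|))) := by
    have hc : Continuous fun h : ℝ => ∏ i, ∏ j ∈ univ.erase i,
        (|x i - x j| ^ 2 * |x i - x j + h| * |x i - x j - h|) := by
      fun_prop
    refine ((hc.tendsto 0).mono_left nhdsWithin_le_nhds).congr' ?_
    filter_upwards [self_mem_nhdsWithin] with h hh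
    exact (hdet h hh).symm
  have h3 := tendsto_nhds_unique hl1 hl2
  have h4 : |C.det| ^ 2 = (|vandermondeProd x| ^ 4) ^ 2 := by
    rw [h3, vandermondeProd_sq_eq_det, show ∀ a : ℝ, (a ^ 4) ^ 2 = (a ^ 2) ^ 4 by intro a; ring,
      abs_det_vandermonde_sq]
    simp_rw [← Finset.prod_pow]
    refine prod_congr rfl fun i _ => prod_congr rfl fun j _ => ?_
    simp only [add_zero, sub_zero]; ring
  exact (pow_left_inj₀ (abs_nonneg _) (by positivity) two_ne_zero).1 h4

/-! ### Moments of an atomic measure as coordinates -/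

/-- Index set of the `2 m + 1` real parameters of a Jacobi matrix of size `m + 1`. -/
abbrev Idx (m : ℕ) : Type := Fin (m + 1) ⊕ Fin m

/-- An enumeration of `1, …, 2 m + 1` by the parameters of a Jacobi matrix. -/
def expo {m : ℕ} : Idx m → ℕ := Sum.elim (fun k => 2 * (k : ℕ) + 1) (fun k => 2 * (k : ℕ) + 2)

@[simp] theorem expo_inl {m : ℕ} (k : Fin (m + 1)) : expo (Sum.inl k : Idx m) = 2 * (k : ℕ) + 1 := rfl

@[simp] theorem expo_inr {m : ℕ} (k : Fin m) : expo (Sum.inr k : Idx m) = 2 * (k : ℕ) + 2 := rfl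

theorem expo_injective {m : ℕ} : Function.Injective (expo : Idx m → ℕ) := by
  rintro (a | a) (b | b) h <;> simp only [expo_inl, expo_inr] at h
  · congr 1; ext; omega
  · omega
  · omega
  · congr 1; ext; omega

theorem exists_expo_eq {m i : ℕ} (h0 : i ≠ 0) (hi : i < 2 * (m + 1)) : ∃ j : Idx m, expo j = i := by
  rcases Nat.even_or_odd' i with ⟨k, rfl | rfl⟩
  · exact ⟨Sum.inr ⟨k - 1, by omega⟩, by simp only [expo_inr]; omega⟩
  · exact ⟨Sum.inl ⟨k, by omega⟩, by simp⟩

/-- The point of the hyperplane `∑ w i = 1` with given first coordinates. -/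
def weights {m : ℕ} (u : Fin m → ℝ) : Fin (m + 1) → ℝ := Fin.snoc u (1 - ∑ j, u j)

@[simp] theorem weights_castSucc {m : ℕ} (u : Fin m → ℝ) (i : Fin m) :
    weights u i.castSucc = u i := by simp [weights]

@[simp] theorem weights_last {m : ℕ} (u : Fin m → ℝ) :
    weights u (Fin.last m) = 1 - ∑ j, u j := by simp [weights]

theorem simplexPoint_eq_weights {m : ℕ} (u : Fin m → ℝ) : simplexPoint (m + 1) u = weights u := by
  ext i
  refine Fin.lastCases ?_ (fun i => ?_) i
  · rw [weights_last, simplexPoint, dif_neg (by simp)]; rfl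
  · rw [weights_castSucc, simplexPoint, dif_pos (by simp)]; rfl

theorem sum_weights {m : ℕ} (u : Fin m → ℝ) : ∑ i, weights u i = 1 := by
  simp [Fin.sum_univ_castSucc]

theorem weights_comp_castSucc {m : ℕ} (w : Fin (m + 1) → ℝ) (h : ∑ i, w i = 1) :
    weights (fun i => w i.castSucc) = w := by
  ext i
  refine Fin.lastCases ?_ (fun i => ?_) i
  · rw [weights_last, ← h, Fin.sum_univ_castSucc]; ring
  · simp

/-- The moments of order `1, …, 2 m + 1` of the measure with atoms `x (inl i)` and weights
determined by `x (inr i)`. -/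
def atomicMoment {m : ℕ} (x : Idx m → ℝ) (j : Idx m) : ℝ :=
  ∑ i, weights (fun i => x (Sum.inr i)) i * x (Sum.inl i) ^ expo j

/-- A map with differentiable components has its Jacobian matrix as derivative. -/
theorem hasFDerivAt_of_hasLineDerivAt {ι : Type*} [Fintype ι] [DecidableEq ι]
    {M : (ι → ℝ) → ι → ℝ} {x : ι → ℝ} {J : Matrix ι ι ℝ}
    (hd : ∀ j, DifferentiableAt ℝ (fun y => M y j) x)
    (hJ : ∀ j l, HasLineDerivAt ℝ (fun y => M y j) (J j l) x (Pi.single l 1)) :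
    HasFDerivAt M (LinearMap.toContinuousLinearMap (Matrix.toLin' J)) x := by
  rw [hasFDerivAt_pi']
  intro j
  refine (hd j).hasFDerivAt.congr_fderiv ?_
  apply ContinuousLinearMap.coe_injective
  refine LinearMap.pi_ext' fun l => ?_
  apply LinearMap.ext_ring
  have h2 := ((hd j).hasFDerivAt.hasLineDerivAt (Pi.single l 1)).unique (hJ j l)
  simp [h2]

/-- The Jacobian matrix of `atomicMoment`. -/
def atomicJacobian {m : ℕ} (x : Idx m → ℝ) : Matrix (Idx m) (Idx m) ℝ := Matrix.of fun j l =>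
  Sum.elim (fun i => weights (fun i => x (Sum.inr i)) i * (expo j * x (Sum.inl i) ^ (expo j - 1)))
    (fun i => x (Sum.inl i.castSucc) ^ expo j - x (Sum.inl (Fin.last m)) ^ expo j) l

theorem atomicMoment_eq {m : ℕ} (x : Idx m → ℝ) (j : Idx m) :
    atomicMoment x j = ∑ i : Fin m, x (Sum.inr i) * x (Sum.inl i.castSucc) ^ expo j
      + (1 - ∑ i : Fin m, x (Sum.inr i)) * x (Sum.inl (Fin.last m)) ^ expo j := by
  simp [atomicMoment, Fin.sum_univ_castSucc]

theorem differentiable_atomicMoment {m : ℕ} (j : Idx m) :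
    Differentiable ℝ (fun x : Idx m → ℝ => atomicMoment x j) := by
  simp_rw [atomicMoment_eq]
  fun_prop

theorem hasFDerivAt_atomicMoment {m : ℕ} (x : Idx m → ℝ) :
    HasFDerivAt atomicMoment (LinearMap.toContinuousLinearMap (Matrix.toLin' (atomicJacobian x)))
      x := by
  refine hasFDerivAt_of_hasLineDerivAt (fun j => differentiable_atomicMoment j x) fun j l => ?_
  rw [HasLineDerivAt]
  obtain ⟨v, hv⟩ : ∃ v : Idx m → ℝ, v = Pi.single l 1 := ⟨_, rfl⟩
  rw [← hv]
  have hlin : ∀ l' : Idx m, HasDerivAt (fun t : ℝ => (x + t • v) l') (v l') 0 := by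
    intro l'
    simpa using ((hasDerivAt_id (0 : ℝ)).mul_const (v l')).const_add (x l')
  have hsum := HasDerivAt.fun_sum (u := univ) fun (i : Fin m) _ => hlin (Sum.inr i)
  have hpow := fun i : Fin (m + 1) => (hlin (Sum.inl i)).fun_pow (expo j)
  have h := (HasDerivAt.fun_sum (u := univ) fun (i : Fin m) _ =>
    (hlin (Sum.inr i)).fun_mul (hpow i.castSucc)).fun_add
      ((hsum.const_sub 1).fun_mul (hpow (Fin.last m)))
  simp_rw [atomicMoment_eq]
  refine HasDerivAt.congr_deriv h ?_
  simp only [zero_smul, add_zero, hv]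
  rcases l with l | l
  -- The last atom is separate because its weight is not a coordinate but one minus the sum of the
  -- others.
  · refine Fin.lastCases ?_ (fun i => ?_) l
    · simp [atomicJacobian, (Fin.castSucc_lt_last _).ne]
    · simp [atomicJacobian, Pi.single_apply, (Fin.castSucc_lt_last _).ne']
  · simp [atomicJacobian, Pi.single_apply]
    ring

/-- Each atom column carries its weight as a factor. The weight columns are differences of value
columns, as in a confluent Vandermonde matrix from which the row of exponent `0` and the value
column of the last atom have been eliminated. -/
theorem abs_det_atomicJacobian {m : ℕ} (x : Idx m → ℝ) :
    |(atomicJacobian x).det| = |∏ i, weights (fun i => x (Sum.inr i)) i|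
      * |vandermondeProd fun i => x (Sum.inl i)| ^ 4 := by
  -- The extra index `Unit` stands for the row of exponent `0` and for the value column of the last
  -- atom.
  let r : Idx m ⊕ Unit → Fin (m + 1) ⊕ Fin (m + 1) :=
    Sum.elim (Sum.elim Sum.inl fun i => Sum.inr i.succ) fun _ => Sum.inr 0
  let c : Idx m ⊕ Unit → Fin (m + 1) ⊕ Fin (m + 1) :=
    Sum.elim (Sum.elim Sum.inl fun i => Sum.inr i.castSucc) fun _ => Sum.inr (Fin.last m)
  have hr : Function.Bijective r := by
    rw [Fintype.bijective_iff_injective_and_card]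
    refine ⟨?_, by simp; omega⟩
    rintro ((a | a) | a) ((b | b) | b) h <;> simp_all [r, (Fin.succ_ne_zero _).symm]
  have hc : Function.Bijective c := by
    rw [Fintype.bijective_iff_injective_and_card]
    refine ⟨?_, by simp; omega⟩
    rintro ((a | a) | a) ((b | b) | b) h <;>
      simp_all [c, (Fin.castSucc_lt_last _).ne, (Fin.castSucc_lt_last _).ne']
  let e : Fin (m + 1) ⊕ Fin (m + 1) → ℕ :=
    Sum.elim (fun k => 2 * (k : ℕ) + 1) (fun k => 2 * (k : ℕ))
  have he : Function.Injective e := by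
    rintro (a | a) (b | b) h <;> simp only [e, Sum.elim_inl, Sum.elim_inr] at h
    · congr 1; ext; omega
    · omega
    · omega
    · congr 1; ext; omega
  have hlt : ∀ k, e k < 2 * (m + 1) := by
    rintro (a | a) <;> simp only [e, Sum.elim_inl, Sum.elim_inr] <;> omega
  have key := abs_det_confluent e he hlt fun i => x (Sum.inl i)
  set C : Matrix (Fin (m + 1) ⊕ Fin (m + 1)) (Fin (m + 1) ⊕ Fin (m + 1)) ℝ := Matrix.of _ with hC
  let J₀ : Matrix (Idx m) (Idx m) ℝ := Matrix.of fun j l =>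
    Sum.elim (fun i => expo j * x (Sum.inl i) ^ (expo j - 1))
      (fun i => x (Sum.inl i.castSucc) ^ expo j - x (Sum.inl (Fin.last m)) ^ expo j) l
  -- The right factor subtracts the last value column from the other value columns. In the row of
  -- exponent `0` this leaves only the final `1`, so the product is block triangular; the truncated
  -- exponent `0 - 1` there is multiplied by `0`.
  have h1 : C.submatrix (Equiv.ofBijective r hr) (Equiv.ofBijective c hc) *
      Matrix.fromBlocks 1 0 (Matrix.of fun _ => Sum.elim (fun _ => 0) fun _ => -1) 1
      = Matrix.fromBlocks J₀ (Matrix.of fun j _ => x (Sum.inl (Fin.last m)) ^ expo j) 0 1 := by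
    ext j l
    rcases j with (j | j) | j <;> rcases l with (l | l) | l <;>
      simp [C, J₀, Matrix.mul_apply, Fintype.sum_sum_type, Matrix.one_apply, r, c, e, mul_add,
        sub_eq_add_neg]
  have h2 : atomicJacobian x
      = J₀ * Matrix.diagonal (Sum.elim (weights fun i => x (Sum.inr i)) fun _ => 1) := by
    ext j l
    rcases l with l | l <;> simp [atomicJacobian, J₀, mul_comm]
  have h3 := congrArg (fun A => |A.det|) h1
  simp only [Matrix.det_mul, Matrix.det_fromBlocks_zero₁₂, Matrix.det_fromBlocks_zero₂₁,
    Matrix.det_one, mul_one] at h3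
  rw [Matrix.abs_det_submatrix_equiv_equiv, key] at h3
  rw [h2, Matrix.det_mul, Matrix.det_diagonal, Fintype.prod_sum_type]
  simp only [Sum.elim_inl, Sum.elim_inr, prod_const_one, mul_one]
  rw [abs_mul, ← h3, mul_comm]

/-! ### Injectivity of the moments of an atomic measure -/

/-- Strictly ordered atoms and positive weights. -/
def spectralDomain (m : ℕ) : Set (Idx m → ℝ) :=
  {x | StrictAnti (fun i => x (Sum.inl i)) ∧ ∀ i, 0 < weights (fun i => x (Sum.inr i)) i}

/-- The moment of order `0` is not recorded but equals `1` on both sides, so all monomials of degree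
at most `2 m + 1` are covered. -/
theorem sum_weights_eval_eq {m : ℕ} {x y : Idx m → ℝ} (h : atomicMoment x = atomicMoment y)
    (p : Polynomial ℝ) (hp : p.natDegree < 2 * (m + 1)) :
    ∑ i, weights (fun i => x (Sum.inr i)) i * p.eval (x (Sum.inl i))
      = ∑ i, weights (fun i => y (Sum.inr i)) i * p.eval (y (Sum.inl i)) := by
  have h1 : ∀ z : Idx m → ℝ, ∑ i, weights (fun i => z (Sum.inr i)) i * p.eval (z (Sum.inl i))
      = ∑ k ∈ range (2 * (m + 1)), p.coeff k *
        ∑ i, weights (fun i => z (Sum.inr i)) i * z (Sum.inl i) ^ k := by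
    intro z
    simp_rw [Polynomial.eval_eq_sum_range' hp, mul_sum]
    rw [sum_comm]
    exact sum_congr rfl fun k _ => sum_congr rfl fun i _ => by ring
  rw [h1, h1]
  refine sum_congr rfl fun k hk => ?_
  congr 1
  rcases eq_or_ne k 0 with rfl | h0
  · simp [sum_weights]
  · obtain ⟨j, rfl⟩ := exists_expo_eq h0 (mem_range.1 hk)
    exact congrFun h j

/-- Test against the polynomial of degree `2 m + 1` vanishing at all atoms of `y` and at all atoms
of `x` but the `k`-th. If that atom were missing from `y`, one side would be zero and the other a
positive weight times a nonzero value. -/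
theorem atoms_subset_of_atomicMoment_eq {m : ℕ} {x y : Idx m → ℝ} (hx : x ∈ spectralDomain m)
    (h : atomicMoment x = atomicMoment y) (k : Fin (m + 1)) :
    ∃ i, x (Sum.inl k) = y (Sum.inl i) := by
  by_contra! hk
  let p : Polynomial ℝ := (∏ i, (Polynomial.X - Polynomial.C (y (Sum.inl i)))) *
    ∏ i ∈ univ.erase k, (Polynomial.X - Polynomial.C (x (Sum.inl i)))
  have hp : p.natDegree < 2 * (m + 1) := by
    refine lt_of_le_of_lt Polynomial.natDegree_mul_le ?_
    rw [Polynomial.natDegree_finsetProd_X_sub_C_eq_card, Polynomial.natDegree_finsetProd_X_sub_C_eq_card,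
      card_erase_of_mem (mem_univ k)]
    simp; omega
  have h1 := sum_weights_eval_eq h p hp
  rw [sum_eq_single k] at h1
  · rw [sum_eq_zero] at h1
    · rcases mul_eq_zero.1 h1 with h2 | h2
      · exact (hx.2 k).ne' h2
      · simp only [p, Polynomial.eval_mul, Polynomial.eval_prod, Polynomial.eval_sub,
          Polynomial.eval_X, Polynomial.eval_C, mul_eq_zero, prod_eq_zero_iff, mem_univ, true_and,
          mem_erase, and_true, sub_eq_zero] at h2
        rcases h2 with ⟨i, hi⟩ | ⟨i, hi, h3⟩
        · exact hk i hi
        · exact hi (hx.1.injective h3).symm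
    · intro i _
      simp only [p, Polynomial.eval_mul, Polynomial.eval_prod]
      rw [prod_eq_zero (mem_univ i)] <;> simp
  · intro i _ hi
    simp only [p, Polynomial.eval_mul, Polynomial.eval_prod]
    rw [prod_eq_zero (i := i) (s := univ.erase k)] <;> simp [hi]
  · simp

/-- The atoms agree as sets, hence as decreasing sequences; a polynomial vanishing at all atoms but
one then isolates each weight. -/
theorem injOn_atomicMoment (m : ℕ) : Set.InjOn (atomicMoment (m := m)) (spectralDomain m) := by
  intro x hx y hy h
  have hrange : Set.range (fun i => x (Sum.inl i)) = Set.range (fun i => y (Sum.inl i)) := by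
    ext t; constructor
    · rintro ⟨k, rfl⟩
      obtain ⟨i, hi⟩ := atoms_subset_of_atomicMoment_eq hx h k
      exact ⟨i, hi.symm⟩
    · rintro ⟨k, rfl⟩
      obtain ⟨i, hi⟩ := atoms_subset_of_atomicMoment_eq hy h.symm k
      exact ⟨i, hi.symm⟩
  have hatoms : ∀ i, x (Sum.inl i) = y (Sum.inl i) := by
    -- Negation turns decreasing enumerations into increasing ones, which are determined by their
    -- range.
    have := (StrictMono.range_inj (f := fun i => -x (Sum.inl i)) (g := fun i => -y (Sum.inl i))
      (fun a b hab => neg_lt_neg (hx.1 hab)) (fun a b hab => neg_lt_neg (hy.1 hab))).1 (by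
        have h2 := congrArg (fun S => Neg.neg '' S) hrange
        simpa only [← Set.range_comp, Function.comp_def] using h2)
    intro i
    simpa using congrFun this i
  have hw : ∀ k, weights (fun i => x (Sum.inr i)) k = weights (fun i => y (Sum.inr i)) k := by
    intro k
    let p : Polynomial ℝ := ∏ i ∈ univ.erase k, (Polynomial.X - Polynomial.C (x (Sum.inl i)))
    have hp : p.natDegree < 2 * (m + 1) := by
      rw [Polynomial.natDegree_finsetProd_X_sub_C_eq_card, card_erase_of_mem (mem_univ k)]
      simp; omega
    have hp0 : ∀ i, i ≠ k → p.eval (x (Sum.inl i)) = 0 := by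
      intro i hi
      simp only [p, Polynomial.eval_prod]
      rw [prod_eq_zero (i := i)] <;> simp [hi]
    have hpk : p.eval (x (Sum.inl k)) ≠ 0 := by
      simp only [p, Polynomial.eval_prod, prod_ne_zero_iff]
      intro i hi h3
      simp only [Polynomial.eval_sub, Polynomial.eval_X, Polynomial.eval_C, sub_eq_zero] at h3
      exact (mem_erase.1 hi).1 (hx.1.injective h3).symm
    have h1 := sum_weights_eval_eq h p hp
    simp_rw [← hatoms] at h1
    rw [sum_eq_single k (fun i _ hi => by rw [hp0 i hi, mul_zero]) (by simp),
      sum_eq_single k (fun i _ hi => by rw [hp0 i hi, mul_zero]) (by simp)] at h1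
    exact mul_right_cancel₀ hpk h1
  ext l
  rcases l with l | l
  · exact hatoms l
  · simpa using hw l.castSucc

/-! ### Moments of a Jacobi matrix as coordinates -/

/-- The Jacobi matrix with diagonal `y (inl i)` and off-diagonal `y (inr i) / √2`. -/
def jac {m : ℕ} (y : Idx m → ℝ) : Matrix (Fin (m + 1)) (Fin (m + 1)) ℝ :=
  jacobiMatrix (n := m + 1) (fun i => y (Sum.inl i)) (fun i => y (Sum.inr i) / √2)

theorem jac_self {m : ℕ} (y : Idx m → ℝ) (i : Fin (m + 1)) : jac y i i = y (Sum.inl i) := by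
  simp [jac, jacobiMatrix]

theorem jac_succ_castSucc {m : ℕ} (y : Idx m → ℝ) (i : Fin m) :
    jac y i.succ i.castSucc = y (Sum.inr i) / √2 := by
  have h1 : i.succ ≠ i.castSucc := (Fin.castSucc_lt_succ).ne'
  simp only [jac, jacobiMatrix, if_neg h1]
  rw [dif_neg (by simp; omega), dif_pos (by simp)]
  rfl

theorem jac_comm {m : ℕ} (y : Idx m → ℝ) (i l : Fin (m + 1)) : jac y i l = jac y l i := by
  simp only [jac, jacobiMatrix]
  split_ifs <;> first | rfl | omega | (subst_vars; rfl)

theorem jac_eq_zero {m : ℕ} (y : Idx m → ℝ) {i l : Fin (m + 1)} (h : (l : ℕ) + 1 < i) :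
    jac y i l = 0 := by
  simp only [jac, jacobiMatrix]
  split_ifs <;> first | rfl | omega

/-- Case distinction on the position of an entry of a Jacobi matrix. -/
theorem jac_cases {m : ℕ} (i l : Fin (m + 1)) :
    (i = l) ∨ (∃ k : Fin m, i = k.succ ∧ l = k.castSucc) ∨
      (∃ k : Fin m, l = k.succ ∧ i = k.castSucc) ∨ ((l : ℕ) + 1 < i) ∨ ((i : ℕ) + 1 < l) := by
  rcases lt_trichotomy (i : ℕ) l with h | h | h
  · rcases (Nat.succ_le_of_lt h).eq_or_lt with h2 | h2
    · exact Or.inr (Or.inr (Or.inl ⟨⟨i, by omega⟩, Fin.ext h2.symm, rfl⟩))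
    · exact Or.inr (Or.inr (Or.inr (Or.inr h2)))
  · exact Or.inl (Fin.ext h)
  · rcases (Nat.succ_le_of_lt h).eq_or_lt with h2 | h2
    · exact Or.inr (Or.inl ⟨⟨l, by omega⟩, Fin.ext h2.symm, rfl⟩)
    · exact Or.inr (Or.inr (Or.inr (Or.inl h2)))

/-- Inside the band, the entry at `(i, l)` depends only on the parameter with `expo = i + l + 1`: `2
i + 1` on the diagonal, `2 k + 2` at `(k + 1, k)`. -/
theorem jac_congr {m R : ℕ} {y z : Idx m → ℝ} (h : ∀ p, expo p < R → y p = z p)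
    (i l : Fin (m + 1)) (hil : (i : ℕ) + l + 1 < R) : jac y i l = jac z i l := by
  rcases jac_cases i l with rfl | ⟨k, rfl, rfl⟩ | ⟨k, rfl, rfl⟩ | h2 | h2
  · rw [jac_self, jac_self, h]; simp; omega
  · rw [jac_succ_castSucc, jac_succ_castSucc, h]; simp at hil ⊢; omega
  · rw [jac_comm, jac_comm z, jac_succ_castSucc, jac_succ_castSucc, h]; simp at hil ⊢; omega
  · rw [jac_eq_zero y h2, jac_eq_zero z h2]
  · rw [jac_comm, jac_comm z, jac_eq_zero y h2, jac_eq_zero z h2]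

theorem differentiable_jac {m : ℕ} (i l : Fin (m + 1)) :
    Differentiable ℝ (fun y : Idx m → ℝ => jac y i l) := by
  rcases jac_cases i l with rfl | ⟨k, rfl, rfl⟩ | ⟨k, rfl, rfl⟩ | h2 | h2
  · simp_rw [jac_self]; fun_prop
  · simp_rw [jac_succ_castSucc]; fun_prop
  · simp_rw [jac_comm _ k.castSucc, jac_succ_castSucc]; fun_prop
  · simp_rw [jac_eq_zero _ h2]; fun_prop
  · simp_rw [jac_comm _ i, jac_eq_zero _ h2]; fun_prop

/-! ### Krylov vectors and triangularity of the moments -/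

/-- The `k`-th Krylov vector of a Jacobi matrix, started at the first basis vector. -/
def krylov {m : ℕ} (y : Idx m → ℝ) (k : ℕ) (i : Fin (m + 1)) : ℝ := (jac y ^ k) i 0

theorem krylov_zero {m : ℕ} (y : Idx m → ℝ) (i : Fin (m + 1)) :
    krylov y 0 i = if i = 0 then 1 else 0 := by
  simp [krylov, Matrix.one_apply]

theorem krylov_succ {m : ℕ} (y : Idx m → ℝ) (k : ℕ) (i : Fin (m + 1)) :
    krylov y (k + 1) i = ∑ l, jac y i l * krylov y k l := by
  simp [krylov, pow_succ', Matrix.mul_apply]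

theorem krylov_eq_zero {m : ℕ} (y : Idx m → ℝ) {k : ℕ} :
    ∀ {i : Fin (m + 1)}, k < i → krylov y k i = 0 := by
  induction k with
  | zero => intro i hi; rw [krylov_zero, if_neg]; rintro rfl; simp at hi
  | succ k ih =>
    intro i hi
    rw [krylov_succ]
    refine sum_eq_zero fun l _ => ?_
    rcases lt_or_ge k (l : ℕ) with h | h
    · rw [ih h, mul_zero]
    · rw [jac_eq_zero y (by omega), zero_mul]

/-- The product of the first `k` off-diagonal entries. -/
def offProd {m : ℕ} (y : Idx m → ℝ) (k : ℕ) : ℝ :=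
  ∏ i ∈ univ.filter (fun i : Fin m => (i : ℕ) < k), y (Sum.inr i) / √2

theorem offProd_zero {m : ℕ} (y : Idx m → ℝ) : offProd y 0 = 1 := by simp [offProd]

theorem offProd_succ {m : ℕ} (y : Idx m → ℝ) (k : Fin m) :
    offProd y (k + 1) = y (Sum.inr k) / √2 * offProd y k := by
  have : (univ.filter fun i : Fin m => (i : ℕ) < k + 1)
      = insert k (univ.filter fun i : Fin m => (i : ℕ) < k) := by
    ext i; simp only [mem_filter, mem_univ, true_and, mem_insert, Fin.ext_iff]; omega
  rw [offProd, this, prod_insert (by simp)]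
  rfl

theorem offProd_congr {m : ℕ} {y z : Idx m → ℝ} {k : ℕ}
    (h : ∀ p, expo p < 2 * k + 1 → y p = z p) : offProd y k = offProd z k := by
  refine prod_congr rfl fun i hi => ?_
  rw [h]
  simp at hi ⊢; omega

/-- The only path of length `k` from `0` to `k` climbs at every step, collecting the first `k`
off-diagonal entries. -/
theorem krylov_self {m : ℕ} (y : Idx m → ℝ) (k : Fin (m + 1)) : krylov y k k = offProd y k := by
  induction k using Fin.induction with
  | zero => simp [krylov_zero, offProd_zero]
  | succ k ih =>
    rw [Fin.val_succ, krylov_succ, offProd_succ, sum_eq_single k.castSucc]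
    · rw [jac_succ_castSucc]
      rw [Fin.val_castSucc] at ih
      rw [ih]
    · intro l _ hl
      rcases lt_or_ge (k : ℕ) (l : ℕ) with h | h
      · rw [krylov_eq_zero y h, mul_zero]
      · have : (l : ℕ) ≠ k := fun h3 => hl (Fin.ext h3)
        rw [jac_eq_zero y (by simp; omega), zero_mul]
    · simp

/-- A path of length `k` from `0` to `i` only uses edges `(a, b)` with `a + b + 1 ≤ k + i`, hence
only parameters of index at most `k + i`. -/
theorem krylov_congr {m R : ℕ} {y z : Idx m → ℝ} (h : ∀ p, expo p < R → y p = z p) (k : ℕ) :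
    ∀ i : Fin (m + 1), k + i < R → krylov y k i = krylov z k i := by
  induction k with
  | zero => intro i _; rw [krylov_zero, krylov_zero]
  | succ k ih =>
    intro i hi
    rw [krylov_succ, krylov_succ]
    refine sum_congr rfl fun l _ => ?_
    rcases lt_or_ge k (l : ℕ) with h1 | h1
    · rw [krylov_eq_zero y h1, krylov_eq_zero z h1, mul_zero, mul_zero]
    · rw [jac_congr h i l (by omega)]
      rcases lt_or_ge ((i : ℕ) + 1) l with h2 | h2
      · rw [jac_comm, jac_eq_zero z h2, zero_mul, zero_mul]
      · rw [ih l (by omega)]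

theorem differentiable_krylov {m : ℕ} (k : ℕ) :
    ∀ i : Fin (m + 1), Differentiable ℝ (fun y : Idx m → ℝ => krylov y k i) := by
  induction k with
  | zero => intro i; simp_rw [krylov_zero]; fun_prop
  | succ k ih =>
    intro i
    simp_rw [krylov_succ]
    exact Differentiable.fun_sum fun l _ => (differentiable_jac i l).fun_mul (ih l)

/-- The moments of order `1, …, 2 m + 1` of the spectral measure of a Jacobi matrix. -/
def jacobiMoment {m : ℕ} (y : Idx m → ℝ) (j : Idx m) : ℝ := (jac y ^ expo j) 0 0

theorem jac_pow_comm {m : ℕ} (y : Idx m → ℝ) (k : ℕ) (i l : Fin (m + 1)) :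
    (jac y ^ k) i l = (jac y ^ k) l i := by
  have : (jac y).transpose = jac y := by ext a b; exact jac_comm y b a
  conv_rhs => rw [← this, ← Matrix.transpose_pow, Matrix.transpose_apply]

theorem jac_pow_add {m : ℕ} (y : Idx m → ℝ) (k l : ℕ) :
    (jac y ^ (k + l)) 0 0 = ∑ i, krylov y k i * krylov y l i := by
  simp [pow_add, Matrix.mul_apply, krylov, jac_pow_comm y k 0]

/-- The moment of order `2 k + 1` is the quadratic form of the matrix at the `k`-th Krylov vector.
The term `(k, k)` is split off because it alone contains the `k`-th diagonal entry. -/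
theorem jacobiMoment_inl {m : ℕ} (y : Idx m → ℝ) (k : Fin (m + 1)) :
    jacobiMoment y (Sum.inl k) = offProd y k ^ 2 * y (Sum.inl k) +
      ∑ p ∈ univ.erase (k, k), krylov y k p.1 * (jac y p.1 p.2 * krylov y k p.2) := by
  rw [jacobiMoment, expo_inl, show 2 * (k : ℕ) + 1 = k + (k + 1) by ring, jac_pow_add]
  simp_rw [krylov_succ, mul_sum]
  rw [← Fintype.sum_prod_type' fun i l => krylov y k i * (jac y i l * krylov y k l),
    ← add_sum_erase _ _ (mem_univ (k, k)), jac_self, krylov_self]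
  ring

/-- The moment of order `2 k + 2` is the squared norm of the Krylov vector of index `k + 1`, whose
last nonzero coordinate alone contains the `k`-th off-diagonal entry. -/
theorem jacobiMoment_inr {m : ℕ} (y : Idx m → ℝ) (k : Fin m) :
    jacobiMoment y (Sum.inr k) = offProd y k ^ 2 * (y (Sum.inr k) ^ 2 / 2) +
      ∑ i ∈ univ.erase k.succ, krylov y (k + 1) i ^ 2 := by
  rw [jacobiMoment, expo_inr, show 2 * (k : ℕ) + 2 = (k + 1) + (k + 1) by ring, jac_pow_add,
    ← add_sum_erase _ _ (mem_univ k.succ)]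
  have := krylov_self y k.succ
  rw [Fin.val_succ] at this
  rw [this, offProd_succ]
  congr 1
  · have h2 : √(2 : ℝ) ≠ 0 := by positivity
    have h3 : √(2 : ℝ) ^ 2 = 2 := Real.sq_sqrt (by norm_num)
    field_simp
    rw [h3]; ring
  · exact sum_congr rfl fun i _ => (sq _).symm

/-- The factor in front of the last parameter in a moment of a Jacobi matrix. -/
def leadCoeff {m : ℕ} (y : Idx m → ℝ) : Idx m → ℝ :=
  Sum.elim (fun k => offProd y k ^ 2) (fun k => offProd y k ^ 2)

/-- The dependence on the last parameter in a moment of a Jacobi matrix. -/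
def leadFun {m : ℕ} (j : Idx m) (t : ℝ) : ℝ := Sum.elim (fun _ => t) (fun _ => t ^ 2 / 2) j

theorem leadCoeff_congr {m : ℕ} {y z : Idx m → ℝ} {j : Idx m}
    (h : ∀ p, expo p < expo j → y p = z p) : leadCoeff y j = leadCoeff z j := by
  rcases j with k | k <;> simp only [leadCoeff, Sum.elim_inl, Sum.elim_inr]
  · rw [offProd_congr h]
  · rw [offProd_congr fun p hp => h p (hp.trans (by simp))]

/-- A moment of a Jacobi matrix is triangular in the parameters. -/
theorem jacobiMoment_sub_congr {m : ℕ} {y z : Idx m → ℝ} {j : Idx m}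
    (h : ∀ p, expo p < expo j → y p = z p) :
    jacobiMoment y j - leadCoeff y j * leadFun j (y j)
      = jacobiMoment z j - leadCoeff z j * leadFun j (z j) := by
  rcases j with k | k
  · simp only [jacobiMoment_inl, leadCoeff, leadFun, Sum.elim_inl, add_sub_cancel_left]
    refine sum_congr rfl fun p hp => ?_
    rw [expo_inl] at h
    rcases lt_or_ge (k : ℕ) (p.1 : ℕ) with h1 | h1
    · rw [krylov_eq_zero y h1, krylov_eq_zero z h1, zero_mul, zero_mul]
    rcases lt_or_ge (k : ℕ) (p.2 : ℕ) with h2 | h2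
    · simp only [krylov_eq_zero y h2, krylov_eq_zero z h2, mul_zero]
    -- Both indices are at most `k` and not both equal to `k`, so their sum is less than `2 k` and
    -- only earlier parameters occur.
    have h3 : ¬ ((p.1 : ℕ) = k ∧ (p.2 : ℕ) = k) := fun h3 =>
      (mem_erase.1 hp).1 (Prod.ext (Fin.ext h3.1) (Fin.ext h3.2))
    rw [krylov_congr h k p.1 (by omega), krylov_congr h k p.2 (by omega),
      jac_congr h p.1 p.2 (by omega)]
  · simp only [jacobiMoment_inr, leadCoeff, leadFun, Sum.elim_inr, add_sub_cancel_left]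
    refine sum_congr rfl fun i hi => ?_
    rw [expo_inr] at h
    have h3 : (i : ℕ) ≠ k + 1 := fun h3 => (mem_erase.1 hi).1 (Fin.ext (by simpa using h3))
    rcases lt_or_ge ((k : ℕ) + 1) (i : ℕ) with h1 | h1
    · rw [krylov_eq_zero y h1, krylov_eq_zero z h1]
    · rw [krylov_congr h (k + 1) i (by omega)]

theorem differentiable_jacobiMoment {m : ℕ} (j : Idx m) :
    Differentiable ℝ (fun y : Idx m → ℝ => jacobiMoment y j) :=
  differentiable_krylov (expo j) 0

/-- The parameters of Jacobi matrices with positive off-diagonal entries. -/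
def jacobiDomain (m : ℕ) : Set (Idx m → ℝ) := {y | ∀ i, 0 < y (Sum.inr i)}

theorem offProd_pos {m : ℕ} {y : Idx m → ℝ} (hy : y ∈ jacobiDomain m) (k : ℕ) :
    0 < offProd y k :=
  prod_pos fun i _ => div_pos (hy i) (by positivity)

theorem leadCoeff_pos {m : ℕ} {y : Idx m → ℝ} (hy : y ∈ jacobiDomain m) (j : Idx m) :
    0 < leadCoeff y j := by
  rcases j with k | k <;> exact pow_pos (offProd_pos hy _) 2

/-- Parameters are recovered one by one in the order of `expo`: the leading coefficient is positive,
and positivity of the off-diagonal entries selects the square root. -/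
theorem injOn_jacobiMoment (m : ℕ) : Set.InjOn (jacobiMoment (m := m)) (jacobiDomain m) := by
  intro y hy z hz h
  have main : ∀ R : ℕ, ∀ p : Idx m, expo p < R → y p = z p := by
    intro R
    induction R with
    | zero => intro p hp; omega
    | succ R ih =>
      intro p hp
      rcases Nat.lt_succ_iff_lt_or_eq.1 hp with hp | rfl
      · exact ih p hp
      have h1 := jacobiMoment_sub_congr ih
      rw [h, leadCoeff_congr ih, sub_right_inj] at h1
      have h2 := mul_left_cancel₀ (leadCoeff_pos hz p).ne' h1
      rcases p with k | k
      · exact h2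
      · simp only [leadFun, Sum.elim_inr] at h2
        exact (pow_left_inj₀ (hy k).le (hz k).le two_ne_zero).1 (by linarith)
  ext p
  exact main _ p (Nat.lt_succ_self _)

/-! ### The Jacobian determinant of the triangular moment map -/

/-- The Jacobian matrix of `jacobiMoment`. -/
def jacobiJacobian {m : ℕ} (y : Idx m → ℝ) : Matrix (Idx m) (Idx m) ℝ :=
  Matrix.of fun j l => lineDeriv ℝ (fun z => jacobiMoment z j) y (Pi.single l 1)

theorem hasFDerivAt_jacobiMoment {m : ℕ} (y : Idx m → ℝ) :
    HasFDerivAt jacobiMoment (LinearMap.toContinuousLinearMap (Matrix.toLin' (jacobiJacobian y)))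
      y :=
  hasFDerivAt_of_hasLineDerivAt (fun j => differentiable_jacobiMoment j y) fun j _ =>
    (differentiable_jacobiMoment j y).lineDifferentiableAt.hasLineDerivAt

/-- Moving a parameter that is not earlier than `j` changes only the leading term, and not even that
when `l ≠ j`. This gives the Jacobian entries on and above the diagonal without differentiating
matrix powers. -/
theorem jacobiMoment_add_single {m : ℕ} (y : Idx m → ℝ) {j l : Idx m} (hl : expo j ≤ expo l)
    (t : ℝ) : jacobiMoment (y + t • Pi.single l 1) j
      = leadCoeff y j * leadFun j ((y + t • (Pi.single l 1 : Idx m → ℝ)) j) +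
        (jacobiMoment y j - leadCoeff y j * leadFun j (y j)) := by
  have h : ∀ p, expo p < expo j → (y + t • (Pi.single l 1 : Idx m → ℝ)) p = y p := by
    intro p hp
    have : p ≠ l := by rintro rfl; omega
    simp [this]
  rw [← jacobiMoment_sub_congr h, leadCoeff_congr h]
  ring

theorem jacobiJacobian_of_lt {m : ℕ} (y : Idx m → ℝ) {j l : Idx m} (h : expo j < expo l) :
    jacobiJacobian y j l = 0 := by
  have hjl : j ≠ l := by rintro rfl; omega
  simp only [jacobiJacobian, Matrix.of_apply, lineDeriv, jacobiMoment_add_single y h.le]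
  simp [hjl]

theorem jacobiJacobian_inl {m : ℕ} (y : Idx m → ℝ) (k : Fin (m + 1)) :
    jacobiJacobian y (Sum.inl k) (Sum.inl k) = offProd y k ^ 2 := by
  simp only [jacobiJacobian, Matrix.of_apply, lineDeriv, jacobiMoment_add_single y le_rfl]
  simp [leadFun, leadCoeff]

theorem jacobiJacobian_inr {m : ℕ} (y : Idx m → ℝ) (k : Fin m) :
    jacobiJacobian y (Sum.inr k) (Sum.inr k) = offProd y k ^ 2 * y (Sum.inr k) := by
  simp only [jacobiJacobian, Matrix.of_apply, lineDeriv, jacobiMoment_add_single y le_rfl]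
  simp only [leadFun, leadCoeff, Sum.elim_inr, Pi.add_apply, Pi.smul_apply, Pi.single_eq_same,
    smul_eq_mul, mul_one]
  have h := (((((hasDerivAt_id (0 : ℝ)).const_add (y (Sum.inr k))).pow 2).div_const 2).const_mul
    (offProd y k ^ 2)).add_const (jacobiMoment y (Sum.inr k) -
      offProd y k ^ 2 * (y (Sum.inr k) ^ 2 / 2))
  refine h.deriv.trans ?_
  simp

theorem det_jacobiJacobian {m : ℕ} (y : Idx m → ℝ) :
    (jacobiJacobian y).det = (∏ k : Fin (m + 1), offProd y k ^ 2) *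
      ∏ k : Fin m, (offProd y k ^ 2 * y (Sum.inr k)) := by
  -- Ordering the parameters by `expo` interleaves diagonal and off-diagonal ones, which makes the
  -- matrix lower triangular.
  let _ : LinearOrder (Idx m) := LinearOrder.lift' expo expo_injective
  have h : (jacobiJacobian y).det = ∏ j, jacobiJacobian y j j := by
    convert Matrix.det_of_isLowerTriangular (jacobiJacobian y) _
    intro j l hjl
    exact jacobiJacobian_of_lt y hjl
  rw [h, Fintype.prod_sum_type]
  simp_rw [jacobiJacobian_inl, jacobiJacobian_inr]

/-- The extra factor `y (inr k) / 2` completes `offProd y k ^ 2 * y (inr k)` to `offProd y (k + 1) ^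
2`, so the two products in the determinant become equal. -/
theorem det_jacobiJacobian_mul {m : ℕ} (y : Idx m → ℝ) :
    (jacobiJacobian y).det * ∏ k : Fin m, (y (Sum.inr k) / 2)
      = (∏ k : Fin (m + 1), offProd y k) ^ 4 := by
  have h1 : (∏ k : Fin m, (offProd y k ^ 2 * y (Sum.inr k))) * ∏ k : Fin m, (y (Sum.inr k) / 2)
      = ∏ k : Fin (m + 1), offProd y k ^ 2 := by
    rw [Fin.prod_univ_succ, Fin.val_zero, offProd_zero, one_pow, one_mul, ← prod_mul_distrib]
    refine prod_congr rfl fun k _ => ?_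
    have h3 : √(2 : ℝ) ^ 2 = 2 := Real.sq_sqrt (by norm_num)
    rw [Fin.val_succ, offProd_succ, mul_pow, div_pow, h3]
    ring
  rw [det_jacobiJacobian, mul_assoc, h1, prod_pow]
  ring

/-- The `i`-th off-diagonal entry occurs in `offProd y k` exactly for the `m - i` indices `k > i`.
-/
theorem prod_offProd {m : ℕ} (y : Idx m → ℝ) :
    ∏ k : Fin (m + 1), offProd y k = ∏ i : Fin m, (y (Sum.inr i) / √2) ^ (m - (i : ℕ)) := by
  simp_rw [offProd]
  rw [prod_comm' (t' := univ) (s' := fun i : Fin m => univ.filter fun k : Fin (m + 1) => (i : ℕ) < k)]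
  · refine prod_congr rfl fun i _ => ?_
    rw [prod_const]
    congr 1
    have : (univ.filter fun k : Fin (m + 1) => (i : ℕ) < k) = Ioi i.castSucc := by
      ext k; simp [Fin.lt_def]
    rw [this, Fin.card_Ioi]; simp
  · intro k i; simp

/-! ### Spectral data of a Jacobi matrix -/

section Diagonalization

variable {m : ℕ} {y : Idx m → ℝ} {Q : Matrix (Fin (m + 1)) (Fin (m + 1)) ℝ} {l : Fin (m + 1) → ℝ}

theorem mul_diagonal_mul_transpose_apply {n : ℕ} (Q : Matrix (Fin n) (Fin n) ℝ) (d : Fin n → ℝ)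
    (i j : Fin n) : (Q * Matrix.diagonal d * Q.transpose) i j = ∑ p, Q i p * d p * Q j p := by
  rw [Matrix.mul_apply]
  simp_rw [Matrix.mul_diagonal, Matrix.transpose_apply]

theorem pow_apply_of_eq {n : ℕ} {T Q : Matrix (Fin n) (Fin n) ℝ} {l : Fin n → ℝ}
    (hQ : Q ∈ Matrix.orthogonalGroup (Fin n) ℝ)
    (hT : T = Q * Matrix.diagonal l * Q.transpose) (k : ℕ) (i j : Fin n) :
    (T ^ k) i j = ∑ p, Q i p * l p ^ k * Q j p := by
  have h : T ^ k = Q * Matrix.diagonal (fun p => l p ^ k) * Q.transpose := by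
    induction k with
    | zero =>
      have := (Matrix.mem_orthogonalGroup_iff (Fin n) ℝ).1 hQ
      simpa using this.symm
    | succ k ih =>
      have h2 : Q.transpose * Q = 1 := (Matrix.mem_orthogonalGroup_iff' (Fin n) ℝ).1 hQ
      rw [pow_succ, ih]
      calc _ = Q * Matrix.diagonal (fun p => l p ^ k) * Q.transpose *
            (Q * Matrix.diagonal l * Q.transpose) := by rw [← hT]
        _ = Q * Matrix.diagonal (fun p => l p ^ k) * (Q.transpose * Q) * Matrix.diagonal l
            * Q.transpose := by simp only [Matrix.mul_assoc]
        _ = _ := by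
          rw [h2, Matrix.mul_one, Matrix.mul_assoc Q, Matrix.diagonal_mul_diagonal]
          simp_rw [pow_succ]
  rw [h, mul_diagonal_mul_transpose_apply]

theorem sum_row_sq_eq_one {n : ℕ} {Q : Matrix (Fin n) (Fin n) ℝ}
    (hQ : Q ∈ Matrix.orthogonalGroup (Fin n) ℝ) (i : Fin n) : ∑ p, Q i p ^ 2 = 1 := by
  have := congrFun (congrFun ((Matrix.mem_orthogonalGroup_iff (Fin n) ℝ).1 hQ) i) i
  simpa [Matrix.mul_apply, sq] using this

/-- Product of the off-diagonal entries in terms of the spectral data. -/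
theorem prod_offProd_sq (h : IsOrderedDiagonalization (jac y) Q l) :
    (∏ k : Fin (m + 1), offProd y k) ^ 2 = (∏ p, Q 0 p ^ 2) * |vandermondeProd l| ^ 2 := by
  obtain ⟨-, hQ, hT⟩ := h
  -- The Krylov matrix is upper triangular with diagonal `offProd`; diagonalization also factors it
  -- as orthogonal times diagonal times Vandermonde.
  let K : Matrix (Fin (m + 1)) (Fin (m + 1)) ℝ := Matrix.of fun i k => krylov y k i
  have h1 : K.det = ∏ k : Fin (m + 1), offProd y k := by
    rw [Matrix.det_of_isUpperTriangular]
    · exact prod_congr rfl fun k _ => krylov_self y k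
    · intro i k hik
      exact krylov_eq_zero y hik
  have h2 : K = Q * (Matrix.diagonal (Q 0) * Matrix.vandermonde l) := by
    ext i k
    simp only [K, Matrix.of_apply, krylov, pow_apply_of_eq hQ hT, Matrix.mul_apply (M := Q),
      Matrix.diagonal_mul, Matrix.vandermonde_apply]
    exact sum_congr rfl fun p _ => by ring
  have h3 : Q.det ^ 2 = 1 := by
    have := congrArg Matrix.det ((Matrix.mem_orthogonalGroup_iff (Fin (m + 1)) ℝ).1 hQ)
    rw [Matrix.det_mul, Matrix.det_transpose, Matrix.det_one] at this
    rw [sq, this]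
  rw [← h1, h2, Matrix.det_mul, Matrix.det_mul, Matrix.det_diagonal, vandermondeProd_sq_eq_det,
    sq_abs, mul_pow, mul_pow, h3, one_mul, prod_pow]

/-- The atoms and weights of the spectral measure at the first basis vector. -/
def spectralData (Q : Matrix (Fin (m + 1)) (Fin (m + 1)) ℝ) (l : Fin (m + 1) → ℝ) : Idx m → ℝ :=
  Sum.elim l fun i => Q 0 i.castSucc ^ 2

theorem weights_spectralData (hQ : Q ∈ Matrix.orthogonalGroup (Fin (m + 1)) ℝ) :
    weights (fun i => spectralData Q l (Sum.inr i)) = fun p => Q 0 p ^ 2 :=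
  weights_comp_castSucc (fun p => Q 0 p ^ 2) (sum_row_sq_eq_one hQ 0)

theorem vandermondeProd_eq_zero {n : ℕ} {x : Fin n → ℝ} {i j : Fin n} (hij : i ≠ j)
    (h : x i = x j) : vandermondeProd x = 0 := by
  rw [← abs_eq_zero, vandermondeProd_sq_eq_det, abs_eq_zero, Matrix.det_vandermonde_eq_zero_iff]
  exact ⟨i, j, h, hij⟩

/-- By `prod_offProd_sq`, positive off-diagonal entries make `∏ Q 0 p ^ 2 * Δ ^ 2` positive, which
excludes repeated eigenvalues and vanishing first components. -/
theorem spectralData_mem (hy : y ∈ jacobiDomain m) (h : IsOrderedDiagonalization (jac y) Q l) :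
    spectralData Q l ∈ spectralDomain m := by
  have h1 := prod_offProd_sq h
  have h2 : 0 < (∏ k : Fin (m + 1), offProd y k) ^ 2 :=
    pow_pos (prod_pos fun (k : Fin (m + 1)) _ => offProd_pos hy k) 2
  rw [h1] at h2
  obtain ⟨hl, hQ, hT⟩ := h
  refine ⟨hl.strictAnti_of_injective fun i j hij => ?_, fun p => ?_⟩
  · by_contra hne
    rw [vandermondeProd_eq_zero hne hij] at h2
    simp at h2
  · rw [weights_spectralData hQ]
    refine lt_of_le_of_ne (sq_nonneg _) fun h0 => ?_
    rw [prod_eq_zero (mem_univ p) h0.symm] at h2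
    simp at h2

theorem atomicMoment_spectralData (h : IsOrderedDiagonalization (jac y) Q l) :
    atomicMoment (spectralData Q l) = jacobiMoment y := by
  obtain ⟨hl, hQ, hT⟩ := h
  ext j
  rw [atomicMoment, weights_spectralData hQ, jacobiMoment, pow_apply_of_eq hQ hT]
  exact sum_congr rfl fun p _ => by simp only [spectralData, Sum.elim_inl]; ring

/-- Both sides are the trace of the square. Each off-diagonal entry is counted twice, which the
normalization by `√2` compensates. -/
theorem sum_sq_eq (h : IsOrderedDiagonalization (jac y) Q l) : ∑ j, y j ^ 2 = ∑ p, l p ^ 2 := by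
  obtain ⟨hl, hQ, hT⟩ := h
  have h1 : Matrix.trace (jac y ^ 2) = ∑ p, l p ^ 2 := by
    simp_rw [Matrix.trace, Matrix.diag_apply, pow_apply_of_eq hQ hT]
    rw [sum_comm]
    refine sum_congr rfl fun p _ => ?_
    have := sum_row_sq_eq_one (Q := Q.transpose) (by
      rw [Matrix.mem_orthogonalGroup_iff]
      simpa [Matrix.star_eq_conjTranspose] using
        (Matrix.mem_orthogonalGroup_iff' (Fin (m + 1)) ℝ).1 hQ) p
    simp only [Matrix.transpose_apply] at this
    calc _ = ∑ i, l p ^ 2 * Q i p ^ 2 := sum_congr rfl fun i _ => by ring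
      _ = _ := by rw [← mul_sum, this, mul_one]
  have h2 : Matrix.trace (jac y ^ 2) = ∑ i, ∑ k, jac y i k ^ 2 := by
    simp_rw [Matrix.trace, Matrix.diag_apply, sq (jac y), Matrix.mul_apply]
    exact sum_congr rfl fun i _ => sum_congr rfl fun k _ => by rw [jac_comm y k i, sq]
  have h4 : √(2 : ℝ) ^ 2 = 2 := Real.sq_sqrt (by norm_num)
  -- Writing the entries with indicators allows the sum over positions to be exchanged with the sum
  -- over parameters.
  have h3 : ∀ i k : Fin (m + 1), jac y i k ^ 2 = (if i = k then y (Sum.inl i) ^ 2 else 0)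
      + ∑ p : Fin m, ((if i = p.succ ∧ k = p.castSucc then y (Sum.inr p) ^ 2 / 2 else 0)
        + (if k = p.succ ∧ i = p.castSucc then y (Sum.inr p) ^ 2 / 2 else 0)) := by
    intro i k
    have e1 : ∀ q p : Fin m, ¬ (q.castSucc = p.succ ∧ q.succ = p.castSucc) := by
      intro q p h; simp only [Fin.ext_iff, Fin.val_castSucc, Fin.val_succ] at h; omega
    have e2 : ∀ q : Fin m, q.succ ≠ q.castSucc := fun q => (Fin.castSucc_lt_succ).ne'
    rcases jac_cases i k with rfl | ⟨q, rfl, rfl⟩ | ⟨q, rfl, rfl⟩ | h2 | h2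
    · rw [jac_self, if_pos rfl, sum_eq_zero, add_zero]
      intro p _
      have e3 : ¬ (i = p.succ ∧ i = p.castSucc) := fun h => e2 p (h.1.symm.trans h.2)
      rw [if_neg e3, add_zero]
    · rw [jac_succ_castSucc, if_neg (e2 q), sum_eq_single q]
      · rw [if_pos ⟨rfl, rfl⟩, if_neg (e1 q q), div_pow, h4]; ring
      · intro p _ hp
        rw [if_neg (fun h => hp (Fin.succ_injective _ h.1).symm), if_neg (e1 q p), add_zero]
      · simp
    · rw [jac_comm, jac_succ_castSucc, if_neg (e2 q).symm, sum_eq_single q]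
      · rw [if_neg (e1 q q), if_pos ⟨rfl, rfl⟩, div_pow, h4]; ring
      · intro p _ hp
        rw [if_neg (e1 q p), if_neg (fun h => hp (Fin.succ_injective _ h.1).symm), add_zero]
      · simp
    · rw [jac_eq_zero y h2, if_neg (by rintro rfl; omega), sum_eq_zero]
      · simp
      · intro p _
        rw [if_neg, if_neg, add_zero] <;> (rintro ⟨rfl, rfl⟩; simp only [Fin.val_succ, Fin.val_castSucc] at h2; omega)
    · rw [jac_comm, jac_eq_zero y h2, if_neg (by rintro rfl; omega), sum_eq_zero]
      · simp
      · intro p _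
        rw [if_neg, if_neg, add_zero] <;> (rintro ⟨rfl, rfl⟩; simp only [Fin.val_succ, Fin.val_castSucc] at h2; omega)
  have h5 : ∀ (p : Fin m) (c : ℝ), ∑ i : Fin (m + 1), ∑ k : Fin (m + 1),
      (if i = p.succ ∧ k = p.castSucc then c else 0) = c := by
    intro p c
    rw [sum_eq_single p.succ, sum_eq_single p.castSucc] <;> simp +contextual
  have h6 : ∀ (p : Fin m) (c : ℝ), ∑ i : Fin (m + 1), ∑ k : Fin (m + 1),
      (if k = p.succ ∧ i = p.castSucc then c else 0) = c := by
    intro p c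
    rw [sum_comm]; exact h5 p c
  rw [← h1, h2, Fintype.sum_sum_type]
  simp_rw [h3, sum_add_distrib]
  congr 1
  · simp
  · simp_rw [fun i : Fin (m + 1) => sum_comm (s := univ) (t := univ)
        (f := fun (k : Fin (m + 1)) (p : Fin m) =>
        if i = p.succ ∧ k = p.castSucc then y (Sum.inr p) ^ 2 / 2 else 0),
      fun i : Fin (m + 1) => sum_comm (s := univ) (t := univ)
        (f := fun (k : Fin (m + 1)) (p : Fin m) =>
        if k = p.succ ∧ i = p.castSucc then y (Sum.inr p) ^ 2 / 2 else 0)]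
    rw [sum_comm, sum_comm (f := fun (i : Fin (m + 1)) (p : Fin m) => ∑ k : Fin (m + 1),
        if k = p.succ ∧ i = p.castSucc then y (Sum.inr p) ^ 2 / 2 else 0)]
    simp_rw [h5, h6, ← sum_add_distrib]
    exact sum_congr rfl fun p _ => by ring

end Diagonalization

/-- A real symmetric matrix has an ordered diagonalization. -/
theorem exists_isOrderedDiagonalization {n : ℕ} {T : Matrix (Fin n) (Fin n) ℝ}
    (hT : ∀ i j, T i j = T j i) : ∃ Q l, IsOrderedDiagonalization T Q l := by
  have hH : T.IsHermitian := by ext i j; simp [hT i j]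
  let σ : Equiv.Perm (Fin n) := Tuple.sort fun i => -hH.eigenvalues i
  have hσ : Monotone ((fun i => -hH.eigenvalues i) ∘ σ) := Tuple.monotone_sort _
  let U : Matrix (Fin n) (Fin n) ℝ := hH.eigenvectorUnitary
  have hU : U ∈ Matrix.orthogonalGroup (Fin n) ℝ := hH.eigenvectorUnitary.2
  have hspec : T = U * Matrix.diagonal hH.eigenvalues * U.transpose := by
    have := hH.spectral_theorem
    simpa [U, Unitary.conjStarAlgAut_apply, Matrix.star_eq_conjTranspose, Function.comp_def]
      using this
  refine ⟨U.submatrix id σ, hH.eigenvalues ∘ σ, ?_, ?_, ?_⟩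
  · intro i j hij
    have := hσ hij
    simpa using this
  · rw [Matrix.mem_orthogonalGroup_iff] at hU ⊢
    rw [← hU]
    ext i j
    simp only [Matrix.mul_apply, Matrix.transpose_apply, Matrix.submatrix_apply, id]
    exact Equiv.sum_comp σ fun p => U i p * U j p
  · nth_rewrite 1 [hspec]
    ext i j
    rw [mul_diagonal_mul_transpose_apply, mul_diagonal_mul_transpose_apply]
    exact (Equiv.sum_comp σ fun p => U i p * hH.eigenvalues p * U j p).symm

/-! ### Every finite measure on the line comes from a Jacobi matrix -/

section Lanczos

open InnerProductSpace Submodule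

theorem inner_gramSchmidt_eq_zero_of_mem_span {E : Type*} [NormedAddCommGroup E]
    [InnerProductSpace ℝ E] {n : ℕ} (f : Fin n → E) (j : Fin n) {v : E}
    (hv : v ∈ span ℝ (f '' Set.Iio j)) : inner ℝ (gramSchmidt ℝ f j) v = 0 := by
  rw [← span_gramSchmidt_Iio] at hv
  induction hv using Submodule.span_induction with
  | mem x hx =>
    obtain ⟨i, hi, rfl⟩ := hx
    exact gramSchmidt_orthogonal ℝ f (ne_of_gt hi)
  | zero => simp
  | add x y _ _ hx hy => rw [inner_add_right, hx, hy, add_zero]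
  | smul a x _ hx => rw [inner_smul_right, hx, mul_zero]

theorem sub_gramSchmidt_mem_span {E : Type*} [NormedAddCommGroup E]
    [InnerProductSpace ℝ E] {n : ℕ} (f : Fin n → E) (j : Fin n) :
    f j - gramSchmidt ℝ f j ∈ span ℝ (f '' Set.Iio j) := by
  rw [← span_gramSchmidt_Iio, gramSchmidt_def ℝ f j, sub_sub_cancel]
  refine Submodule.sum_mem _ fun i hi => ?_
  rw [starProjection_singleton]
  exact Submodule.smul_mem _ _ (subset_span ⟨i, by simpa using hi, rfl⟩)

variable {m : ℕ}

/-- Lanczos procedure: in the orthonormal polynomials of the measure, multiplication by the variable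
is symmetric and raises degrees by at most one, so its matrix is tridiagonal. -/
theorem exists_jacobiMoment_eq {x : Idx m → ℝ} (hx : x ∈ spectralDomain m) :
    ∃ y ∈ jacobiDomain m, jacobiMoment y = atomicMoment x := by
  obtain ⟨hl, hw⟩ := hx
  set l : Fin (m + 1) → ℝ := fun i => x (Sum.inl i) with hl_def
  set w : Fin (m + 1) → ℝ := weights fun i => x (Sum.inr i) with hw_def
  -- The factor `√(w i)` embeds the `L²` space of the measure isometrically; `f k` is the monomial
  -- of degree `k` and `L` is multiplication by the variable.
  let f : Fin (m + 1) → EuclideanSpace ℝ (Fin (m + 1)) := fun k => WithLp.toLp 2 fun i => √(w i) * l i ^ (k : ℕ)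
  let L : EuclideanSpace ℝ (Fin (m + 1)) →ₗ[ℝ] EuclideanSpace ℝ (Fin (m + 1)) :=
    { toFun := fun v => WithLp.toLp 2 fun i => l i * v i
      map_add' := fun u v => by ext i; simp [mul_add]
      map_smul' := fun c v => by ext i; simp; ring }
  have hsq : ∀ i, √(w i) ≠ 0 := fun i => (Real.sqrt_pos.2 (hw i)).ne'
  have hf : LinearIndependent ℝ f := by
    rw [Fintype.linearIndependent_iff]
    intro g hg i
    refine congrFun (Matrix.eq_zero_of_forall_index_sum_pow_mul_eq_zero (v := g) hl.injective
      fun j => ?_) i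
    have h1 := congrArg (fun v : EuclideanSpace ℝ (Fin (m + 1)) => v j) hg
    simp only [f, WithLp.ofLp_sum, WithLp.ofLp_smul, Finset.sum_apply, Pi.smul_apply, smul_eq_mul,
      WithLp.ofLp_zero, Pi.zero_apply] at h1
    have h2 : √(w j) * ∑ i : Fin (m + 1), l j ^ (i : ℕ) * g i = 0 := by
      rw [← h1, mul_sum]; exact sum_congr rfl fun i _ => by ring
    exact (mul_eq_zero.1 h2).resolve_left (hsq j)
  have hLf : ∀ k : Fin m, L (f k.castSucc) = f k.succ := by
    intro k; ext i
    simp [L, f, pow_succ]; ring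
  have hLspan : ∀ k : Fin m, ∀ v ∈ span ℝ (f '' Set.Iic k.castSucc),
      L v ∈ span ℝ (f '' Set.Iic k.succ) := by
    intro k v hv
    have h1 : L v ∈ (span ℝ (f '' Set.Iic k.castSucc)).map L := Submodule.mem_map_of_mem hv
    rw [Submodule.map_span] at h1
    refine span_mono ?_ h1
    rintro _ ⟨_, ⟨i, hi, rfl⟩, rfl⟩
    obtain ⟨i, rfl⟩ : ∃ i' : Fin m, i = i'.castSucc :=
      ⟨⟨i, lt_of_le_of_lt (Fin.le_def.1 hi) k.2⟩, rfl⟩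
    exact ⟨i.succ, by simpa using hi, (hLf i).symm⟩
  have hLspan' : ∀ k : Fin m, ∀ v ∈ span ℝ (f '' Set.Iio k.castSucc),
      L v ∈ span ℝ (f '' Set.Iio k.succ) := by
    intro k v hv
    have h1 : L v ∈ (span ℝ (f '' Set.Iio k.castSucc)).map L := Submodule.mem_map_of_mem hv
    rw [Submodule.map_span] at h1
    refine span_mono ?_ h1
    rintro _ ⟨_, ⟨i, hi, rfl⟩, rfl⟩
    obtain ⟨i, rfl⟩ : ∃ i' : Fin m, i = i'.castSucc :=
      ⟨⟨i, lt_trans (Fin.lt_def.1 hi) k.2⟩, rfl⟩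
    exact ⟨i.succ, by simpa using hi, (hLf i).symm⟩
  set g := gramSchmidt ℝ f with hg_def
  set e := gramSchmidtNormed ℝ f with he_def
  have he : ∀ k, e k = ‖g k‖⁻¹ • g k := fun k => rfl
  have hg0 : ∀ k, 0 < ‖g k‖ := fun k => norm_pos_iff.2 (gramSchmidt_ne_zero k hf)
  have horth : Orthonormal ℝ e := gramSchmidtNormed_orthonormal hf
  let Q : Matrix (Fin (m + 1)) (Fin (m + 1)) ℝ := Matrix.of fun k i => e k i
  have hQ : Q ∈ Matrix.orthogonalGroup (Fin (m + 1)) ℝ := by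
    rw [Matrix.mem_orthogonalGroup_iff]
    ext i j
    have := orthonormal_iff_ite.1 horth j i
    rw [Matrix.mul_apply, Matrix.one_apply]
    simp only [Matrix.transpose_apply, Q, Matrix.of_apply]
    rw [PiLp.inner_apply] at this
    simp only [RCLike.inner_apply, conj_trivial] at this
    rw [this]
    simp only [eq_comm]
  let T : Matrix (Fin (m + 1)) (Fin (m + 1)) ℝ := Q * Matrix.diagonal l * Q.transpose
  have hTapply : ∀ j k, T j k = ∑ p, Q j p * l p * Q k p := mul_diagonal_mul_transpose_apply Q l
  have hT : ∀ j k, T j k = inner ℝ (e j) (L (e k)) := by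
    intro j k
    rw [hTapply, PiLp.inner_apply]
    refine sum_congr rfl fun p _ => ?_
    simp [Q, L]; ring
  have hTsymm : ∀ j k, T j k = T k j := by
    intro j k
    rw [hTapply, hTapply]
    exact sum_congr rfl fun p _ => by ring
  have hTzero : ∀ j k : Fin (m + 1), (k : ℕ) + 1 < j → T j k = 0 := by
    intro j k hjk
    obtain ⟨k, rfl⟩ : ∃ k' : Fin m, k = k'.castSucc := ⟨⟨k, by omega⟩, rfl⟩
    rw [hT, he, he, map_smul, inner_smul_left, inner_smul_right,
      inner_gramSchmidt_eq_zero_of_mem_span f j, mul_zero, mul_zero]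
    refine span_mono (Set.image_mono ?_) (hLspan k _ (gramSchmidt_mem_span ℝ f le_rfl))
    intro i hi
    have h1 : (i : ℕ) ≤ k + 1 := by simpa using Fin.le_def.1 hi
    exact Fin.lt_def.2 (by simp at hjk; omega)
  have hTpos : ∀ k : Fin m, 0 < T k.succ k.castSucc := by
    intro k
    -- `g` is monic up to lower degrees: `L (g k.castSucc)` differs from `g k.succ` by a polynomial
    -- of degree at most `k`, orthogonal to `g k.succ`.
    have h1 : inner ℝ (g k.succ) (L (g k.castSucc)) = ‖g k.succ‖ ^ 2 := by
      have e1 : L (g k.castSucc) = g k.succ + (f k.succ - g k.succ)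
          - L (f k.castSucc - g k.castSucc) := by
        rw [map_sub, hLf]; abel
      rw [e1, inner_sub_right, inner_add_right, real_inner_self_eq_norm_sq,
        inner_gramSchmidt_eq_zero_of_mem_span f _ (sub_gramSchmidt_mem_span f _),
        inner_gramSchmidt_eq_zero_of_mem_span f _
          (hLspan' k _ (sub_gramSchmidt_mem_span f _))]
      ring
    rw [hT, he, he, map_smul, inner_smul_left, inner_smul_right, h1]
    have := hg0 k.succ
    have := hg0 k.castSucc
    simp only [conj_trivial]
    positivity
  let y : Idx m → ℝ := Sum.elim (fun i => T i i) fun i => √2 * T i.succ i.castSucc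
  have h2 : 0 < √(2 : ℝ) := by positivity
  have hjac : jac y = T := by
    ext i k
    rcases jac_cases i k with rfl | ⟨p, rfl, rfl⟩ | ⟨p, rfl, rfl⟩ | h | h
    · rw [jac_self]; rfl
    · rw [jac_succ_castSucc]; simp only [y, Sum.elim_inr]; field_simp
    · rw [jac_comm, jac_succ_castSucc, hTsymm]; simp only [y, Sum.elim_inr]; field_simp
    · rw [jac_eq_zero y h, hTzero _ _ h]
    · rw [jac_comm, jac_eq_zero y h, hTsymm, hTzero _ _ h]
  -- The constant polynomial has norm one as the weights sum to one, so Gram–Schmidt leaves it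
  -- unchanged.
  have hQ0 : ∀ p, Q 0 p = √(w p) := by
    have e1 : g 0 = f 0 := gramSchmidt_bot (𝕜 := ℝ) f
    have e2 : ‖f 0‖ = 1 := by
      rw [EuclideanSpace.norm_eq, Real.sqrt_eq_one, ← sum_weights fun i => x (Sum.inr i)]
      refine sum_congr rfl fun i _ => ?_
      simp only [f, Fin.val_zero, pow_zero, mul_one, Real.norm_eq_abs, sq_abs]
      exact Real.sq_sqrt (hw i).le
    intro p
    simp only [Q, Matrix.of_apply, he, e1, e2]
    simp [f]
  refine ⟨y, fun i => mul_pos h2 (hTpos i), ?_⟩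
  ext j
  rw [jacobiMoment, hjac, pow_apply_of_eq hQ rfl, atomicMoment]
  refine sum_congr rfl fun p _ => ?_
  rw [hQ0, mul_right_comm, Real.mul_self_sqrt (hw p).le]

theorem image_atomicMoment_eq (m : ℕ) :
    atomicMoment '' spectralDomain m = jacobiMoment '' jacobiDomain m := by
  ext z
  constructor
  · rintro ⟨x, hx, rfl⟩
    exact exists_jacobiMoment_eq hx
  · rintro ⟨y, hy, rfl⟩
    obtain ⟨Q, l, h⟩ := exists_isOrderedDiagonalization (jac_comm y)
    exact ⟨_, spectralData_mem hy h, atomicMoment_spectralData h⟩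

/-- The relation between the two Jacobian determinants. -/
theorem abs_det_jacobiJacobian_mul {x y : Idx m → ℝ} (hx : x ∈ spectralDomain m)
    (hy : y ∈ jacobiDomain m) (h : atomicMoment x = jacobiMoment y) :
    |(jacobiJacobian y).det| * ∏ k : Fin m, (y (Sum.inr k) / 2)
      = |(atomicJacobian x).det| * ∏ i, weights (fun i => x (Sum.inr i)) i ∧
    (∏ k : Fin (m + 1), offProd y k) ^ 2 = (∏ i, weights (fun i => x (Sum.inr i)) i) *
      |vandermondeProd fun i => x (Sum.inl i)| ^ 2 ∧
    ∑ j, y j ^ 2 = ∑ i, x (Sum.inl i) ^ 2 := by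
  obtain ⟨Q, l, hd⟩ := exists_isOrderedDiagonalization (jac_comm y)
  -- Injectivity identifies `x` with the spectral data of any diagonalization, making the identities
  -- in `Q` available.
  obtain rfl : x = spectralData Q l :=
    injOn_atomicMoment m hx (spectralData_mem hy hd) (h.trans (atomicMoment_spectralData hd).symm)
  have hprod := prod_offProd_sq hd
  refine ⟨?_, ?_, sum_sq_eq hd⟩
  · have h1 := congrArg abs (det_jacobiJacobian_mul y)
    rw [abs_mul, abs_of_pos (prod_pos fun k _ => half_pos (hy k))] at h1
    rw [h1, abs_det_atomicJacobian, weights_spectralData hd.2.1,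
      abs_of_nonneg (a := ∏ p, Q 0 p ^ 2) (prod_nonneg fun p _ => sq_nonneg _),
      show ∀ a : ℝ, |a ^ 4| = (a ^ 2) ^ 2 by intro a; rw [abs_of_nonneg (by positivity)]; ring,
      hprod]
    simp only [spectralData, Sum.elim_inl]
    ring
  · rw [weights_spectralData hd.2.1]
    exact hprod

end Lanczos

/-! ### Measure-theoretic preliminaries -/

open scoped ENNReal

/-- Change of variables between two coordinate systems with the same image. -/
theorem map_withDensity_of_image_eq {E : Type*} [NormedAddCommGroup E] [NormedSpace ℝ E]
    [FiniteDimensional ℝ E] [MeasurableSpace E] [BorelSpace E] (μ : Measure E) [μ.IsAddHaarMeasure]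
    {f g Φ : E → E} {f' g' : E → E →L[ℝ] E} {X Y : Set E} (hX : MeasurableSet X)
    (hY : MeasurableSet Y) (hf : ∀ x ∈ X, HasFDerivWithinAt f (f' x) X x)
    (hg : ∀ y ∈ Y, HasFDerivWithinAt g (g' y) Y y) (hgm : Measurable g)
    (hfi : Set.InjOn f X) (hgi : Set.InjOn g Y) (himage : f '' X = g '' Y)
    (hdet : ∀ y ∈ Y, (g' y).det ≠ 0) {ρ σ : E → ℝ≥0∞}
    (hρ : ∀ x ∈ X, ∀ y ∈ Y, f x = g y →
      σ y * ENNReal.ofReal |(f' x).det| = ρ x * ENNReal.ofReal |(g' y).det|)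
    (hΦ : ∀ y ∈ Y, Φ y ∈ X ∧ f (Φ y) = g y) :
    AEMeasurable Φ (μ.restrict Y) ∧
      ((μ.restrict Y).withDensity σ).map Φ = (μ.restrict X).withDensity ρ := by
  -- `Φ` is not assumed measurable; its preimages are rewritten as preimages under `g` of images
  -- under the injective differentiable map `f`.
  have hset : ∀ S : Set E, Φ ⁻¹' S ∩ Y = Y ∩ g ⁻¹' (f '' (S ∩ X)) := by
    intro S; ext y; constructor
    · rintro ⟨hS, hy⟩
      exact ⟨hy, Φ y, ⟨hS, (hΦ y hy).1⟩, (hΦ y hy).2⟩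
    · rintro ⟨hy, x, ⟨hS, hx⟩, hxy⟩
      have : Φ y = x := hfi (hΦ y hy).1 hx ((hΦ y hy).2.trans hxy.symm)
      exact ⟨by simpa [this] using hS, hy⟩
  have himS : ∀ S : Set E, MeasurableSet S → MeasurableSet (f '' (S ∩ X)) := fun S hS =>
    measurable_image_of_fderivWithin (hS.inter hX)
      (fun x hx => (hf x hx.2).mono Set.inter_subset_right) (hfi.mono Set.inter_subset_right)
  have hmS : ∀ S : Set E, MeasurableSet S → MeasurableSet (Φ ⁻¹' S ∩ Y) := fun S hS => by
    rw [hset]; exact hY.inter (hgm (himS S hS))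
  have hmeas : AEMeasurable Φ (μ.restrict Y) := by
    refine aemeasurable_restrict_of_measurable_subtype hY fun S hS => ?_
    have : (fun y : Y => Φ y) ⁻¹' S = Subtype.val ⁻¹' (Φ ⁻¹' S ∩ Y) := by ext y; simp
    rw [this]
    exact measurable_subtype_coe (hmS S hS)
  refine ⟨hmeas, ?_⟩
  ext S hS
  rw [Measure.map_apply_of_aemeasurable (hmeas.mono_ac (withDensity_absolutelyContinuous _ _)) hS,
    withDensity_apply', withDensity_apply _ hS, Measure.restrict_restrict' hY,
    Measure.restrict_restrict' hX]
  have himage' : g '' (Φ ⁻¹' S ∩ Y) = f '' (S ∩ X) := by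
    rw [hset]
    refine (Set.image_inter_preimage _ _ _).trans (Set.inter_eq_right.2 ?_)
    rw [← himage]
    exact Set.image_mono Set.inter_subset_right
  let inv : E → E := Function.invFunOn g Y
  have hinv : ∀ y ∈ Y, inv (g y) = y := fun y hy => hgi.leftInvOn_invFunOn hy
  -- `G` is the density in the common image; both sides become the integral of `G` over the same
  -- set.
  let G : E → ℝ≥0∞ := fun z => σ (inv z) / ENNReal.ofReal |(g' (inv z)).det|
  have h0 : ∀ y ∈ Y, ENNReal.ofReal |(g' y).det| ≠ 0 := fun y hy => by
    simpa using hdet y hy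
  have e1 : ∫⁻ y in Φ ⁻¹' S ∩ Y, σ y ∂μ = ∫⁻ z in g '' (Φ ⁻¹' S ∩ Y), G z ∂μ := by
    rw [lintegral_image_eq_lintegral_abs_det_fderiv_mul μ (hmS S hS)
      (fun y hy => (hg y hy.2).mono Set.inter_subset_right) (hgi.mono Set.inter_subset_right)]
    refine setLIntegral_congr_fun (hmS S hS) fun y hy => ?_
    simp only [G, hinv y hy.2]
    rw [ENNReal.mul_div_cancel (h0 y hy.2) ENNReal.ofReal_ne_top]
  have e2 : ∫⁻ x in S ∩ X, ρ x ∂μ = ∫⁻ z in f '' (S ∩ X), G z ∂μ := by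
    rw [lintegral_image_eq_lintegral_abs_det_fderiv_mul μ (hS.inter hX)
      (fun x hx => (hf x hx.2).mono Set.inter_subset_right) (hfi.mono Set.inter_subset_right)]
    refine setLIntegral_congr_fun (hS.inter hX) fun x hx => ?_
    obtain ⟨y, hy, hxy⟩ : f x ∈ g '' Y := himage ▸ Set.mem_image_of_mem f hx.2
    simp only [G, ← hxy, hinv y hy]
    rw [← mul_div_assoc, mul_comm, hρ x hx.2 y hy hxy.symm,
      ENNReal.mul_div_cancel_right (h0 y hy) ENNReal.ofReal_ne_top]
  rw [e1, e2, himage']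

theorem lintegral_fin_prod_eq_prod {n : ℕ} {f : Fin n → ℝ → ℝ≥0∞}
    (hf : ∀ i, Measurable (f i)) :
    ∫⁻ x : Fin n → ℝ, ∏ i, f i (x i) = ∏ i, ∫⁻ t, f i t := by
  induction n with
  | zero => simp [volume_pi]
  | succ n ih =>
    have hm : Measurable fun x : Fin n → ℝ => ∏ i : Fin n, f i.succ (x i) :=
      Finset.measurable_prod _ fun i _ => (hf _).comp (measurable_pi_apply i)
    rw [← (volume_preserving_piFinSuccAbove (fun _ : Fin (n + 1) => ℝ) 0).symm.lintegral_comp_emb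
      (MeasurableEquiv.measurableEmbedding _), Fin.prod_univ_succ, ← ih fun i => hf i.succ,
      Measure.volume_eq_prod, ← lintegral_prod_mul (hf 0).aemeasurable hm.aemeasurable]
    refine lintegral_congr fun z => ?_
    simp [MeasurableEquiv.piFinSuccAbove_symm_apply, Fin.prod_univ_succ]

theorem lintegral_fintype_prod_eq_prod {ι : Type*} [Fintype ι] {f : ι → ℝ → ℝ≥0∞}
    (hf : ∀ i, Measurable (f i)) :
    ∫⁻ x : ι → ℝ, ∏ i, f i (x i) = ∏ i, ∫⁻ t, f i t := by
  let e := (Fintype.equivFin ι).symm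
  rw [← (volume_measurePreserving_piCongrLeft (fun _ => ℝ) e).lintegral_comp_emb
      (MeasurableEquiv.measurableEmbedding _)]
  simp_rw [← e.prod_comp, MeasurableEquiv.coe_piCongrLeft, Equiv.piCongrLeft_apply_apply]
  exact lintegral_fin_prod_eq_prod fun i => hf (e i)

/-- A product of measures with densities has the product density. -/
theorem pi_withDensity {ι : Type*} [Fintype ι] {f : ι → ℝ → ℝ≥0∞} (hf : ∀ i, Measurable (f i))
    [∀ i, SigmaFinite (volume.withDensity (f i))] :
    Measure.pi (fun i => volume.withDensity (f i))
      = (volume : Measure (ι → ℝ)).withDensity fun x => ∏ i, f i (x i) := by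
  refine Measure.pi_eq fun s hs => ?_
  rw [withDensity_apply _ (MeasurableSet.univ_pi hs), ← lintegral_indicator (MeasurableSet.univ_pi hs)]
  have h1 : ∀ i, volume.withDensity (f i) (s i) = ∫⁻ t, (s i).indicator (f i) t := fun i => by
    rw [withDensity_apply _ (hs i), lintegral_indicator (hs i)]
  simp_rw [h1]
  rw [← lintegral_fintype_prod_eq_prod fun i => (hf i).indicator (hs i)]
  refine lintegral_congr fun x => ?_
  by_cases hx : x ∈ Set.univ.pi s
  · rw [Set.indicator_of_mem hx]
    exact prod_congr rfl fun i _ => (Set.indicator_of_mem (hx i trivial) _).symm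
  · rw [Set.indicator_of_notMem hx]
    simp only [Set.mem_pi, Set.mem_univ, true_imp_iff, not_forall] at hx
    obtain ⟨i, hi⟩ := hx
    exact (prod_eq_zero (mem_univ i) (Set.indicator_of_notMem hi _)).symm

/-! ### Symmetrization -/

theorem measurePreserving_comp_perm {n : ℕ} (s : Equiv.Perm (Fin n)) :
    MeasurePreserving (fun x : Fin n → ℝ => x ∘ s) :=
  volume_preserving_arrowCongr' s.symm (MeasurableEquiv.refl ℝ) (MeasurePreserving.id _)

theorem volume_tie {n : ℕ} {i j : Fin n} (hij : i ≠ j) :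
    volume {x : Fin n → ℝ | x i = x j} = 0 := by
  let S : Submodule ℝ (Fin n → ℝ) :=
    LinearMap.ker (LinearMap.proj (R := ℝ) (φ := fun _ : Fin n => ℝ) i - LinearMap.proj j)
  have h1 : {x : Fin n → ℝ | x i = x j} = S := by
    ext x; simp [S, sub_eq_zero]
  rw [h1]
  refine Measure.addHaar_submodule _ S fun h => ?_
  have h2 : (Pi.single i 1 : Fin n → ℝ) ∈ S := h ▸ Submodule.mem_top
  simp [S, hij.symm] at h2

theorem measurableSet_strictAnti (n : ℕ) : MeasurableSet {x : Fin n → ℝ | StrictAnti x} := by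
  simp only [StrictAnti, Set.ofPred_forall]
  refine MeasurableSet.iInter fun i => MeasurableSet.iInter fun j => MeasurableSet.iInter fun _ => ?_
  exact measurableSet_lt (measurable_pi_apply j) (measurable_pi_apply i)

/-- A permutation invariant measure without ties is determined on invariant sets by its restriction
to the chamber of decreasing vectors. -/
theorem measure_eq_factorial_mul {n : ℕ} {μ : Measure (Fin n → ℝ)}
    (hμ : ∀ s : Equiv.Perm (Fin n), MeasurePreserving (fun x : Fin n → ℝ => x ∘ s) μ μ)
    (htie : ∀ i j, i ≠ j → μ {x | x i = x j} = 0) {A : Set (Fin n → ℝ)} (hA : MeasurableSet A)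
    (hinv : ∀ (s : Equiv.Perm (Fin n)) (x : Fin n → ℝ), x ∈ A → x ∘ s ∈ A) :
    μ A = n.factorial * μ (A ∩ {x | StrictAnti x}) := by
  have hinv' : ∀ (s : Equiv.Perm (Fin n)) (x : Fin n → ℝ), x ∘ s ∈ A ↔ x ∈ A := by
    refine fun s x => ⟨fun h => ?_, hinv s x⟩
    have := hinv s⁻¹ _ h
    rwa [Function.comp_assoc, ← Equiv.Perm.coe_mul, mul_inv_cancel, Equiv.Perm.coe_one,
      Function.comp_id] at this
  have hmS : MeasurableSet (A ∩ {x : Fin n → ℝ | StrictAnti x}) :=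
    hA.inter (measurableSet_strictAnti n)
  -- `C s` collects the points of `A` that `s` sorts; these sets have equal measure, are disjoint,
  -- and cover `A` up to ties.
  let C : Equiv.Perm (Fin n) → Set (Fin n → ℝ) :=
    fun s => (fun x => x ∘ s) ⁻¹' (A ∩ {x | StrictAnti x})
  have hCmem : ∀ s x, x ∈ C s ↔ x ∈ A ∧ StrictAnti (x ∘ s) := fun s x => by
    simp only [C, Set.mem_preimage, Set.mem_inter_iff, hinv', Set.mem_ofPred_eq]
  have hC : ∀ s, μ (C s) = μ (A ∩ {x | StrictAnti x}) := fun s =>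
    (hμ s).measure_preimage hmS.nullMeasurableSet
  have hCm : ∀ s, MeasurableSet (C s) := fun s => (hμ s).measurable hmS
  have hdisj : Pairwise (Function.onFun Disjoint C) := by
    intro s t hst
    refine Set.disjoint_left.2 fun x hs ht => hst ?_
    rw [hCmem] at hs ht
    have h1 : (fun i => -(x ∘ s) i) = fun i => -(x ∘ t) i := by
      refine (StrictMono.range_inj (fun a b h => neg_lt_neg (hs.2 h))
        (fun a b h => neg_lt_neg (ht.2 h))).1 ?_
      have : ∀ u : Equiv.Perm (Fin n), Set.range (fun i => -(x ∘ u) i) = Set.range fun i => -x i :=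
        fun u => u.surjective.range_comp fun i => -x i
      rw [this, this]
    have hxinj : Function.Injective x := by
      have := hs.2.injective.comp s.symm.injective
      simpa [Function.comp_assoc] using this
    ext i
    have h2 := congrFun h1 i
    simp only [Function.comp_apply, neg_inj] at h2
    rw [hxinj h2]
  have hunion : A =ᵐ[μ] ⋃ s, C s := by
    have h1 : ∀ᵐ x ∂μ, ∀ i j : Fin n, i ≠ j → x i ≠ x j := by
      refine ae_all_iff.2 fun i => ae_all_iff.2 fun j => ?_
      by_cases hij : i = j
      · simp [hij]
      · have := htie i j hij
        filter_upwards [measure_eq_zero_iff_ae_notMem.1 this] with x hx _ using hx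
    filter_upwards [h1] with x hx
    refine propext ⟨fun h => ?_, fun h => ?_⟩
    · refine Set.mem_iUnion.2 ⟨Tuple.sort fun i => -x i, (hCmem _ _).2 ⟨h, ?_⟩⟩
      have hm := Tuple.monotone_sort fun i => -x i
      refine Antitone.strictAnti_of_injective (fun i j hij => ?_) ?_
      · simpa using hm hij
      · refine Function.Injective.comp (fun i j hij => ?_) (Equiv.injective _)
        by_contra hne
        exact hx i j hne hij
    · obtain ⟨s, hs⟩ := Set.mem_iUnion.1 h
      exact ((hCmem _ _).1 hs).1
  rw [measure_congr hunion, measure_iUnion hdisj hCm, tsum_fintype]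
  simp [hC, Fintype.card_perm]

/-! ### Normalization of the Dirichlet distribution -/

/-- The unnormalized density of a product of Gamma distributions, without exponential factor. -/
def simplexWeight {n : ℕ} (α : Fin n → ℝ) (w : Fin n → ℝ) : ℝ≥0∞ :=
  ∏ i, ENNReal.ofReal (if 0 < w i then w i ^ (α i - 1) else 0)

theorem measurable_simplexWeight {n : ℕ} (α : Fin n → ℝ) : Measurable (simplexWeight α) := by
  refine Finset.measurable_prod _ fun i _ => ENNReal.measurable_ofReal.comp ?_
  exact Measurable.ite (measurableSet_lt measurable_const (measurable_pi_apply i)) (by fun_prop)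
    measurable_const

theorem simplexWeight_smul {n : ℕ} (α : Fin n → ℝ) {s : ℝ} (hs : 0 < s) (w : Fin n → ℝ) :
    simplexWeight α (s • w) = ENNReal.ofReal (s ^ (∑ i, (α i - 1))) * simplexWeight α w := by
  rw [Real.rpow_sum_of_pos hs, ENNReal.ofReal_prod_of_nonneg (fun i _ => by positivity),
    simplexWeight, simplexWeight, ← prod_mul_distrib]
  refine prod_congr rfl fun i _ => ?_
  rw [← ENNReal.ofReal_mul (by positivity), Pi.smul_apply, smul_eq_mul]
  congr 1
  by_cases h : 0 < w i
  · rw [if_pos h, if_pos (mul_pos hs h), Real.mul_rpow hs.le h.le]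
  · rw [if_neg h, if_neg (by rwa [mul_pos_iff_of_pos_left hs]), mul_zero]

theorem lintegral_gamma {a : ℝ} (ha : 0 < a) :
    ∫⁻ t, ENNReal.ofReal (if 0 < t then t ^ (a - 1) * Real.exp (-t) else 0)
      = ENNReal.ofReal (Real.Gamma a) := by
  have h1 : (fun t : ℝ => ENNReal.ofReal (if 0 < t then t ^ (a - 1) * Real.exp (-t) else 0))
      = (Set.Ioi 0).indicator fun t => ENNReal.ofReal (Real.exp (-t) * t ^ (a - 1)) := by
    ext t
    by_cases h : 0 < t
    · rw [if_pos h, Set.indicator_of_mem (Set.mem_Ioi.2 h), mul_comm]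
    · rw [if_neg h, Set.indicator_of_notMem (by simpa using h), ENNReal.ofReal_zero]
  rw [h1, lintegral_indicator measurableSet_Ioi, Real.Gamma_eq_integral ha,
    ofReal_integral_eq_lintegral_ofReal (Real.GammaIntegral_convergent ha)]
  filter_upwards [ae_restrict_mem measurableSet_Ioi] with t ht
  have : (0 : ℝ) < t := ht
  simp only [Pi.zero_apply]
  positivity

theorem lintegral_comp_smul_pos {m : ℕ} {f : (Fin m → ℝ) → ℝ≥0∞} (hf : Measurable f) {s : ℝ}
    (hs : 0 < s) : ∫⁻ u, f u = ENNReal.ofReal (s ^ m) * ∫⁻ u, f (s • u) := by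
  have h1 := Measure.map_addHaar_smul (volume : Measure (Fin m → ℝ)) hs.ne'
  have h2 : ∫⁻ u, f (s • u) = ∫⁻ u, f u ∂(Measure.map (s • ·) volume) :=
    (lintegral_map hf (measurable_const_smul s)).symm
  rw [h2, h1, lintegral_smul_measure, smul_eq_mul, ← mul_assoc, ← ENNReal.ofReal_mul (by positivity)]
  have h3 : s ^ m ≠ 0 := by positivity
  rw [Module.finrank_fin_fun, abs_of_pos (by positivity), mul_inv_cancel₀ h3, ENNReal.ofReal_one,
    one_mul]

theorem measurable_snoc_sub {m : ℕ} :
    Measurable fun z : (Fin m → ℝ) × ℝ => (Fin.snoc z.1 (z.2 - ∑ i, z.1 i) : Fin (m + 1) → ℝ) := by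
  refine measurable_pi_iff.2 fun i => ?_
  refine Fin.lastCases ?_ (fun i => ?_) i
  · simp only [Fin.snoc_last]; fun_prop
  · simp only [Fin.snoc_castSucc]; fun_prop

theorem simplexWeight_snoc_of_nonpos {m : ℕ} (α : Fin (m + 1) → ℝ) {s : ℝ} (hs : s ≤ 0)
    (u : Fin m → ℝ) : simplexWeight α (Fin.snoc u (s - ∑ i, u i) : Fin (m + 1) → ℝ) = 0 := by
  set w : Fin (m + 1) → ℝ := Fin.snoc u (s - ∑ i, u i) with hw
  have h1 : ∑ i, w i = s := by simp [hw, Fin.sum_univ_castSucc]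
  obtain ⟨i, hi⟩ : ∃ i, w i ≤ 0 := by
    by_contra! h
    have := sum_pos (fun i _ => h i) (univ_nonempty (α := Fin (m + 1)))
    linarith
  exact prod_eq_zero (mem_univ i) (by rw [if_neg hi.not_gt, ENNReal.ofReal_zero])

/-- Scaling to total mass one: homogeneity gives the exponent `∑ (α i - 1)`, and the `m` free
coordinates contribute `s ^ m`. -/
theorem lintegral_simplexWeight_snoc {m : ℕ} (α : Fin (m + 1) → ℝ) {s : ℝ} (hs : 0 < s) :
    ∫⁻ u : Fin m → ℝ, simplexWeight α (Fin.snoc u (s - ∑ i, u i) : Fin (m + 1) → ℝ)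
      = ENNReal.ofReal (s ^ (∑ i, α i - 1)) * ∫⁻ u, simplexWeight α (weights u) := by
  have hm : Measurable fun u : Fin m → ℝ =>
      simplexWeight α (Fin.snoc u (s - ∑ i, u i) : Fin (m + 1) → ℝ) :=
    (measurable_simplexWeight α).comp (measurable_snoc_sub.comp (measurable_id.prodMk measurable_const))
  have h1 : ∀ u : Fin m → ℝ, (Fin.snoc (s • u) (s - ∑ i, (s • u) i) : Fin (m + 1) → ℝ)
      = s • weights u := by
    intro u; ext i
    refine Fin.lastCases ?_ (fun i => ?_) i
    · simp [mul_sub, mul_sum]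
    · simp
  rw [lintegral_comp_smul_pos hm hs]
  simp_rw [h1, simplexWeight_smul α hs]
  rw [lintegral_const_mul' _ _ ENNReal.ofReal_ne_top, ← mul_assoc, ← ENNReal.ofReal_mul (by positivity),
    ← Real.rpow_natCast, ← Real.rpow_add hs]
  congr 3
  simp [sum_sub_distrib]; ring

/-- The Dirichlet integral. -/
theorem lintegral_simplexWeight {m : ℕ} {α : Fin (m + 1) → ℝ} (hα : ∀ i, 0 < α i) :
    ENNReal.ofReal (Real.Gamma (∑ i, α i)) * ∫⁻ u, simplexWeight α (weights u)
      = ENNReal.ofReal (∏ i, Real.Gamma (α i)) := by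
  have hG : ∀ i, Measurable fun t : ℝ =>
      ENNReal.ofReal (if 0 < t then t ^ (α i - 1) * Real.exp (-t) else 0) := fun i =>
    ENNReal.measurable_ofReal.comp
      (Measurable.ite (measurableSet_lt measurable_const measurable_id) (by fun_prop) measurable_const)
  have hprod : ∀ w : Fin (m + 1) → ℝ,
      ∏ i, ENNReal.ofReal (if 0 < w i then w i ^ (α i - 1) * Real.exp (-w i) else 0)
        = ENNReal.ofReal (Real.exp (-∑ i, w i)) * simplexWeight α w := by
    intro w
    rw [← sum_neg_distrib, Real.exp_sum, ENNReal.ofReal_prod_of_nonneg (fun i _ => by positivity),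
      simplexWeight, ← prod_mul_distrib]
    refine prod_congr rfl fun i _ => ?_
    rw [← ENNReal.ofReal_mul (by positivity)]
    congr 1
    split_ifs <;> ring
  have hmeas : Measurable fun z : (Fin m → ℝ) × ℝ => ENNReal.ofReal (Real.exp (-z.2)) *
      simplexWeight α (Fin.snoc z.1 (z.2 - ∑ i, z.1 i) : Fin (m + 1) → ℝ) :=
    (by fun_prop : Measurable fun z : (Fin m → ℝ) × ℝ => ENNReal.ofReal (Real.exp (-z.2))).mul
      ((measurable_simplexWeight α).comp measurable_snoc_sub)
  have hmeas' : Measurable fun z : ℝ × (Fin m → ℝ) =>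
      ENNReal.ofReal (Real.exp (-∑ i, (Fin.snoc z.2 z.1 : Fin (m + 1) → ℝ) i)) *
        simplexWeight α (Fin.snoc z.2 z.1 : Fin (m + 1) → ℝ) := by
    have h : Measurable fun z : ℝ × (Fin m → ℝ) => (Fin.snoc z.2 z.1 : Fin (m + 1) → ℝ) := by
      refine measurable_pi_iff.2 fun i => ?_
      refine Fin.lastCases ?_ (fun i => ?_) i
      · simp only [Fin.snoc_last]; fun_prop
      · simp only [Fin.snoc_castSucc]; fun_prop
    refine Measurable.mul (ENNReal.measurable_ofReal.comp (Real.measurable_exp.comp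
      (Measurable.neg ?_))) ((measurable_simplexWeight α).comp h)
    exact Finset.measurable_sum _ fun i _ => (measurable_pi_apply i).comp h
  -- A product of Gamma densities on `ℝ^(m + 1)` is sliced along the total `s`; the substitution `t
  -- = s - ∑ u` is a translation for fixed `u`.
  calc ENNReal.ofReal (Real.Gamma (∑ i, α i)) * ∫⁻ u, simplexWeight α (weights u)
      = (∫⁻ s, ENNReal.ofReal (if 0 < s then s ^ (∑ i, α i - 1) * Real.exp (-s) else 0)) *
          ∫⁻ u, simplexWeight α (weights u) := by
        rw [lintegral_gamma (sum_pos (fun i _ => hα i) univ_nonempty)]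
    _ = ∫⁻ s : ℝ, ∫⁻ u : Fin m → ℝ, ENNReal.ofReal (Real.exp (-s)) *
          simplexWeight α (Fin.snoc u (s - ∑ i, u i) : Fin (m + 1) → ℝ) := by
        have hm : Measurable fun s : ℝ =>
            ENNReal.ofReal (if 0 < s then s ^ (∑ i, α i - 1) * Real.exp (-s) else 0) :=
          ENNReal.measurable_ofReal.comp (Measurable.ite
            (measurableSet_lt measurable_const measurable_id) (by fun_prop) measurable_const)
        rw [← lintegral_mul_const _ hm]
        refine lintegral_congr fun s => ?_
        rw [lintegral_const_mul' _ _ ENNReal.ofReal_ne_top]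
        by_cases hs : 0 < s
        · rw [if_pos hs, lintegral_simplexWeight_snoc α hs, ← mul_assoc,
            ← ENNReal.ofReal_mul (by positivity), mul_comm (Real.exp _)]
        · simp [if_neg hs, simplexWeight_snoc_of_nonpos α (not_lt.1 hs)]
    _ = ∫⁻ u : Fin m → ℝ, ∫⁻ s : ℝ, ENNReal.ofReal (Real.exp (-s)) *
          simplexWeight α (Fin.snoc u (s - ∑ i, u i) : Fin (m + 1) → ℝ) :=
        (lintegral_lintegral_swap (f := fun (u : Fin m → ℝ) (s : ℝ) => ENNReal.ofReal (Real.exp (-s)) *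
          simplexWeight α (Fin.snoc u (s - ∑ i, u i) : Fin (m + 1) → ℝ)) hmeas.aemeasurable).symm
    _ = ∫⁻ u : Fin m → ℝ, ∫⁻ t : ℝ,
          ENNReal.ofReal (Real.exp (-∑ i, (Fin.snoc u t : Fin (m + 1) → ℝ) i)) *
          simplexWeight α (Fin.snoc u t : Fin (m + 1) → ℝ) := by
        refine lintegral_congr fun u => ?_
        rw [← lintegral_add_right_eq_self _ (∑ i, u i)]
        refine lintegral_congr fun t => ?_
        simp [Fin.sum_univ_castSucc, add_comm]
    _ = ∫⁻ w : Fin (m + 1) → ℝ, ENNReal.ofReal (Real.exp (-∑ i, w i)) * simplexWeight α w := by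
        have hm : Measurable fun w : Fin (m + 1) → ℝ =>
            ENNReal.ofReal (Real.exp (-∑ i, w i)) * simplexWeight α w :=
          (by fun_prop : Measurable fun w : Fin (m + 1) → ℝ =>
            ENNReal.ofReal (Real.exp (-∑ i, w i))).mul (measurable_simplexWeight α)
        rw [← (volume_preserving_piFinSuccAbove (fun _ : Fin (m + 1) => ℝ)
          (Fin.last m)).symm.lintegral_comp_emb (MeasurableEquiv.measurableEmbedding _),
          Measure.volume_eq_prod]
        refine Eq.trans ?_ (lintegral_prod _
          (hm.comp (MeasurableEquiv.measurable _)).aemeasurable).symm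
        rw [lintegral_lintegral_swap
          (f := fun (u : Fin m → ℝ) (t : ℝ) =>
            ENNReal.ofReal (Real.exp (-∑ i, (Fin.snoc u t : Fin (m + 1) → ℝ) i)) *
              simplexWeight α (Fin.snoc u t : Fin (m + 1) → ℝ))
          (hmeas'.comp measurable_swap).aemeasurable]
        refine lintegral_congr fun t => lintegral_congr fun u => ?_
        simp [MeasurableEquiv.piFinSuccAbove_symm_apply]
        rfl
    _ = ENNReal.ofReal (∏ i, Real.Gamma (α i)) := by
        simp_rw [← hprod]
        rw [lintegral_fin_prod_eq_prod hG,
          ENNReal.ofReal_prod_of_nonneg fun i _ => (Real.Gamma_pos_of_pos (hα i)).le]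
        exact prod_congr rfl fun i _ => lintegral_gamma (hα i)

/-! ### The densities on both sides -/

/-- Degrees of freedom of the off-diagonal entries. -/
def chiDof (m : ℕ) (β : ℝ) (k : Fin m) : ℝ := (((m + 1 : ℕ) : ℝ) - ((k : ℕ) + 1 : ℝ)) * β

theorem chiDof_eq {m : ℕ} (β : ℝ) (k : Fin m) : chiDof m β k = ((m - (k : ℕ) : ℕ) : ℝ) * β := by
  rw [chiDof, Nat.cast_sub k.2.le]; push_cast; ring

theorem chiDof_pos {m : ℕ} {β : ℝ} (hβ : 0 < β) (k : Fin m) : 0 < chiDof m β k := by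
  rw [chiDof_eq]
  exact mul_pos (Nat.cast_pos.2 (Nat.sub_pos_of_lt k.2)) hβ

/-- The density of the chi distribution. -/
def chiPDF (k t : ℝ) : ℝ :=
  if 0 < t then (2 : ℝ) ^ (1 - k / 2) / Real.Gamma (k / 2) * t ^ (k - 1) * Real.exp (-t ^ 2 / 2)
  else 0

theorem measurable_chiPDF (k : ℝ) : Measurable (chiPDF k) :=
  Measurable.ite (measurableSet_lt measurable_const measurable_id) (by fun_prop) measurable_const

theorem chiPDF_nonneg {k : ℝ} (hk : 0 < k) (t : ℝ) : 0 ≤ chiPDF k t := by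
  have := Real.Gamma_pos_of_pos (half_pos hk)
  rw [chiPDF]; split_ifs <;> positivity

theorem lintegral_chiPDF {k : ℝ} (hk : 0 < k) : ∫⁻ t, ENNReal.ofReal (chiPDF k t) = 1 := by
  have hΓ := Real.Gamma_pos_of_pos (half_pos hk)
  have h1 : (fun t : ℝ => ENNReal.ofReal (chiPDF k t)) = (Set.Ioi 0).indicator fun t =>
      ENNReal.ofReal ((2 : ℝ) ^ (1 - k / 2) / Real.Gamma (k / 2) *
        (t ^ (k - 1) * Real.exp (-(1 / 2) * t ^ (2 : ℝ)))) := by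
    ext t
    by_cases h : 0 < t
    · rw [chiPDF, if_pos h, Set.indicator_of_mem (Set.mem_Ioi.2 h), Real.rpow_two, mul_assoc]
      congr 4; ring
    · rw [chiPDF, if_neg h, Set.indicator_of_notMem (by simpa using h), ENNReal.ofReal_zero]
  have hint : IntegrableOn (fun t : ℝ => t ^ (k - 1) * Real.exp (-(1 / 2) * t ^ (2 : ℝ)))
      (Set.Ioi 0) :=
    integrableOn_rpow_mul_exp_neg_mul_rpow (by linarith) (by norm_num) (by norm_num)
  rw [h1, lintegral_indicator measurableSet_Ioi, ← ofReal_integral_eq_lintegral_ofReal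
    (hint.const_mul _), integral_const_mul, integral_rpow_mul_exp_neg_mul_rpow (by norm_num)
    (by linarith) (by norm_num), ← ENNReal.ofReal_one]
  · congr 1
    rw [show (k - 1 + 1) / 2 = k / 2 by ring, show -(k - 1 + 1) / 2 = -(k / 2) by ring,
      one_div, Real.inv_rpow (by norm_num), Real.rpow_neg (by norm_num), inv_inv,
      Real.rpow_sub (by norm_num), Real.rpow_one]
    have : (2 : ℝ) ^ (k / 2) ≠ 0 := by positivity
    field_simp
  · filter_upwards [ae_restrict_mem measurableSet_Ioi] with t ht
    have : (0 : ℝ) < t := ht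
    simp only [Pi.zero_apply]
    positivity

/-- The densities of the entries of the tridiagonal model. -/
def paramPDF {m : ℕ} (β : ℝ) : Idx m → ℝ → ℝ :=
  Sum.elim (fun _ => gaussianPDFReal 0 1) fun k => chiPDF (chiDof m β k)

/-- The laws of the entries of the tridiagonal model. -/
def paramLaw {m : ℕ} (β : ℝ) (j : Idx m) : Measure ℝ :=
  volume.withDensity fun t => ENNReal.ofReal (paramPDF β j t)

theorem paramLaw_inl {m : ℕ} (β : ℝ) (k : Fin (m + 1)) :
    paramLaw β (Sum.inl k : Idx m) = gaussianReal 0 1 := by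
  rw [gaussianReal_of_var_ne_zero 0 one_ne_zero]; rfl

theorem paramLaw_inr {m : ℕ} (β : ℝ) (k : Fin m) :
    paramLaw β (Sum.inr k : Idx m) = chiMeasure (chiDof m β k) := rfl

theorem isProbabilityMeasure_paramLaw {m : ℕ} {β : ℝ} (hβ : 0 < β) (j : Idx m) :
    IsProbabilityMeasure (paramLaw β j) := by
  rcases j with k | k
  · rw [paramLaw_inl]; infer_instance
  · constructor
    rw [paramLaw, withDensity_apply _ MeasurableSet.univ, Measure.restrict_univ]
    exact lintegral_chiPDF (chiDof_pos hβ k)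

theorem measurable_paramPDF {m : ℕ} (β : ℝ) (j : Idx m) : Measurable (paramPDF β j) := by
  rcases j with k | k
  · exact measurable_gaussianPDFReal 0 1
  · exact measurable_chiPDF _

theorem paramPDF_nonneg {m : ℕ} {β : ℝ} (hβ : 0 < β) (j : Idx m) (t : ℝ) : 0 ≤ paramPDF β j t := by
  rcases j with k | k
  · exact gaussianPDFReal_nonneg 0 1 t
  · exact chiPDF_nonneg (chiDof_pos hβ k) t

/-- The normalization of the symmetric Dirichlet distribution. -/
def dirichletNorm (m : ℕ) (β : ℝ) : ℝ :=
  Real.Gamma (∑ _i : Fin (m + 1), β / 2) / ∏ _i : Fin (m + 1), Real.Gamma (β / 2)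

theorem dirichletNorm_pos (m : ℕ) {β : ℝ} (hβ : 0 < β) : 0 < dirichletNorm m β :=
  div_pos (Real.Gamma_pos_of_pos (sum_pos (fun _ _ => half_pos hβ) univ_nonempty))
    (prod_pos fun _ _ => Real.Gamma_pos_of_pos (half_pos hβ))

/-- The normalization of the density of the ordered eigenvalues. -/
def chamberNorm (m : ℕ) (β : ℝ) : ℝ :=
  (√(2 * Real.pi))⁻¹ ^ (m + 1) * (∏ k : Fin m, (Real.Gamma (chiDof m β k / 2))⁻¹)
    / dirichletNorm m β

theorem chamberNorm_pos (m : ℕ) {β : ℝ} (hβ : 0 < β) : 0 < chamberNorm m β := by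
  refine div_pos (mul_pos (by positivity) (prod_pos fun k _ => inv_pos.2 ?_)) (dirichletNorm_pos m hβ)
  exact Real.Gamma_pos_of_pos (half_pos (chiDof_pos hβ k))

/-- The factor `t / 2` is the one from `det_jacobiJacobian_mul`; it raises the exponent to `k` and,
with `t / √2` as variable, absorbs all powers of `2`. -/
theorem chiPDF_mul_half {k t : ℝ} (ht : 0 < t) :
    chiPDF k t * (t / 2) = (Real.Gamma (k / 2))⁻¹ * (t / √2) ^ k * Real.exp (-(1 / 2) * t ^ 2) := by
  have h2 : (2 : ℝ) ^ (k / 2) = √2 ^ k := by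
    rw [Real.sqrt_eq_rpow, ← Real.rpow_mul (by norm_num)]; congr 1; ring
  rw [chiPDF, if_pos ht, Real.div_rpow ht.le (by positivity), ← h2, Real.rpow_sub (by norm_num),
    Real.rpow_sub ht, Real.rpow_one, Real.rpow_one]
  have : (2 : ℝ) ^ (k / 2) ≠ 0 := by positivity
  rw [show -t ^ 2 / 2 = -(1 / 2) * t ^ 2 by ring]
  field_simp

/-- The degrees of freedom `(m - k) * β` are `β` times the multiplicities in `prod_offProd`, so the
chi factors assemble into one power of `∏ offProd`. -/
theorem prod_paramPDF_mul {m : ℕ} {β : ℝ} {y : Idx m → ℝ} (hy : y ∈ jacobiDomain m) :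
    (∏ j, paramPDF β j (y j)) * ∏ k : Fin m, (y (Sum.inr k) / 2)
      = (√(2 * Real.pi))⁻¹ ^ (m + 1) * (∏ k : Fin m, (Real.Gamma (chiDof m β k / 2))⁻¹) *
        (∏ k : Fin (m + 1), offProd y k) ^ β * Real.exp (-(1 / 2) * ∑ j, y j ^ 2) := by
  rw [Fintype.prod_sum_type, mul_assoc, ← prod_mul_distrib]
  have h1 : ∏ k : Fin (m + 1), paramPDF β (Sum.inl k : Idx m) (y (Sum.inl k))
      = (√(2 * Real.pi))⁻¹ ^ (m + 1) * ∏ k : Fin (m + 1), Real.exp (-(1 / 2) * y (Sum.inl k) ^ 2) := by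
    have : ∀ k : Fin (m + 1), paramPDF β (Sum.inl k : Idx m) (y (Sum.inl k))
        = (√(2 * Real.pi))⁻¹ * Real.exp (-(1 / 2) * y (Sum.inl k) ^ 2) := by
      intro k
      simp only [paramPDF, Sum.elim_inl, gaussianPDFReal, NNReal.coe_one, mul_one, sub_zero]
      congr 2; ring
    simp_rw [this, prod_mul_distrib]
    simp
  have h2 : ∏ k : Fin m, (paramPDF β (Sum.inr k : Idx m) (y (Sum.inr k)) * (y (Sum.inr k) / 2))
      = (∏ k : Fin m, (Real.Gamma (chiDof m β k / 2))⁻¹) * (∏ k : Fin (m + 1), offProd y k) ^ β *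
        ∏ k : Fin m, Real.exp (-(1 / 2) * y (Sum.inr k) ^ 2) := by
    have hb : ∀ k : Fin m, 0 ≤ y (Sum.inr k) / √2 := fun k => div_nonneg (hy k).le (by positivity)
    rw [prod_offProd, ← Real.finsetProd_rpow _ _ fun k _ => pow_nonneg (hb k) _, ← prod_mul_distrib,
      ← prod_mul_distrib]
    refine prod_congr rfl fun k _ => ?_
    rw [← Real.rpow_natCast, ← Real.rpow_mul (hb k), ← chiDof_eq]
    exact chiPDF_mul_half (hy k)
  rw [h1, h2, Fintype.sum_sum_type, mul_add, Real.exp_add, mul_sum, mul_sum, Real.exp_sum,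
    Real.exp_sum]
  ring

/-- The densities on both sides correspond through the two Jacobian determinants. -/
theorem density_relation {m : ℕ} {β : ℝ} (hβ : 0 < β) {x y : Idx m → ℝ} (hx : x ∈ spectralDomain m)
    (hy : y ∈ jacobiDomain m) (h : atomicMoment x = jacobiMoment y) :
    (∏ j, paramPDF β j (y j)) * |(atomicJacobian x).det|
      = chamberNorm m β * gbeWeight (m + 1) β (fun i => x (Sum.inl i)) *
        (dirichletNorm m β * ∏ i, weights (fun i => x (Sum.inr i)) i ^ (β / 2 - 1)) *
        |(jacobiJacobian y).det| := by
  obtain ⟨h1, h2, h3⟩ := abs_det_jacobiJacobian_mul hx hy h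
  set w := weights fun i => x (Sum.inr i) with hw_def
  have hw : ∀ i, 0 < w i := hx.2
  have hW : 0 < ∏ i, w i := prod_pos fun i _ => hw i
  have hD := (dirichletNorm_pos m hβ).ne'
  have hB : 0 ≤ ∏ k : Fin (m + 1), offProd y k := prod_nonneg fun k _ => (offProd_pos hy k).le
  have h4 : (∏ k : Fin (m + 1), offProd y k) ^ β
      = (∏ i, w i) ^ (β / 2) * |vandermondeProd fun i => x (Sum.inl i)| ^ β := by
    have e1 : ∀ a : ℝ, 0 ≤ a → (a ^ 2) ^ (β / 2) = a ^ β := by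
      intro a ha
      rw [← Real.rpow_natCast, ← Real.rpow_mul ha]; congr 1; push_cast; ring
    rw [← e1 _ hB, h2, Real.mul_rpow hW.le (by positivity), e1 _ (abs_nonneg _)]
  have h5 : ∏ i, w i ^ (β / 2 - 1) = (∏ i, w i) ^ (β / 2) / ∏ i, w i := by
    rw [← Real.finsetProd_rpow _ _ fun i _ => (hw i).le, ← prod_div_distrib]
    exact prod_congr rfl fun i _ => by rw [Real.rpow_sub (hw i), Real.rpow_one]
  have h6 := prod_paramPDF_mul (β := β) hy
  rw [h4, h3] at h6
  -- The additional `∏ w` allows `h1` to exchange the Jacobians; dividing by it afterwards produces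
  -- the `-1` in the Dirichlet exponent.
  refine mul_right_cancel₀ hW.ne' ?_
  rw [mul_assoc, ← h1, mul_comm |_| (∏ k : Fin m, _), ← mul_assoc, h6, h5, chamberNorm, gbeWeight]
  field_simp

/-- Normalization constants as an explicit product of Gamma functions. -/
theorem factorial_div_chamberNorm (m : ℕ) {β : ℝ} (hβ : 0 < β) :
    ((m + 1).factorial : ℝ) / chamberNorm m β = (2 * Real.pi) ^ (((m + 1 : ℕ) : ℝ) / 2) *
      ∏ j ∈ Icc 1 (m + 1), Real.Gamma (1 + β / 2 * (j : ℝ)) / Real.Gamma (1 + β / 2) := by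
  have hΓ := Real.Gamma_pos_of_pos (half_pos hβ)
  -- By the functional equation of `Γ`, the `j`-th quotient is `j * Γ(j β / 2) / Γ(β / 2)`; the
  -- factors `j` form the factorial.
  have h1 : ∀ n : ℕ, ∏ j ∈ Icc 1 n, Real.Gamma (1 + β / 2 * (j : ℝ)) / Real.Gamma (1 + β / 2)
      = n.factorial * (∏ i ∈ range n, Real.Gamma (((i + 1 : ℕ) : ℝ) * β / 2)) /
        Real.Gamma (β / 2) ^ n := by
    intro n
    induction n with
    | zero => simp
    | succ n ih =>
      rw [prod_Icc_succ_top (by omega), ih, prod_range_succ, Nat.factorial_succ, pow_succ,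
        add_comm 1 (β / 2), Real.Gamma_add_one (half_pos hβ).ne', add_comm 1 (β / 2 * _),
        Real.Gamma_add_one (by positivity)]
      rw [show β / 2 * ((n + 1 : ℕ) : ℝ) = ((n + 1 : ℕ) : ℝ) * β / 2 by ring]
      push_cast
      field_simp
      exact prod_congr rfl fun x _ => by ring_nf
  -- The chi constants, in reversed order, supply the factors `j ≤ m`; the factor `j = m + 1` comes
  -- from `dirichletNorm`.
  have h2 : ∏ k : Fin m, (Real.Gamma (chiDof m β k / 2))⁻¹
      = (∏ i ∈ range m, Real.Gamma (((i + 1 : ℕ) : ℝ) * β / 2))⁻¹ := by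
    rw [← prod_range_reflect, prod_inv_distrib, _root_.inv_inj,
      ← Fin.prod_univ_eq_prod_range (fun i => Real.Gamma (((m - 1 - i + 1 : ℕ) : ℝ) * β / 2))]
    refine prod_congr rfl fun k _ => ?_
    rw [chiDof_eq, show m - 1 - (k : ℕ) + 1 = m - (k : ℕ) by omega]
  have h3 : 0 < ∏ i ∈ range m, Real.Gamma (((i + 1 : ℕ) : ℝ) * β / 2) :=
    prod_pos fun i _ => Real.Gamma_pos_of_pos (by positivity)
  have h4 : 0 < Real.Gamma (((m + 1 : ℕ) : ℝ) * β / 2) := Real.Gamma_pos_of_pos (by positivity)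
  have h5 : (2 * Real.pi) ^ (((m + 1 : ℕ) : ℝ) / 2) = √(2 * Real.pi) ^ (m + 1) := by
    rw [Real.sqrt_eq_rpow, ← Real.rpow_natCast, ← Real.rpow_mul (by positivity)]; congr 1; ring
  have h6 : 0 < √(2 * Real.pi) := by positivity
  rw [h1, chamberNorm, dirichletNorm, h2, h5, prod_range_succ, inv_pow]
  simp only [sum_const, prod_const, card_univ, Fintype.card_fin, nsmul_eq_mul]
  rw [show ((m + 1 : ℕ) : ℝ) * (β / 2) = ((m + 1 : ℕ) : ℝ) * β / 2 by ring]
  field_simp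
  exact prod_congr rfl fun x _ => by ring_nf

/-! ### The law of the spectral data -/

/-- The density of the Dirichlet distribution in the first coordinates. -/
def dirichletDensity (m : ℕ) (β : ℝ) (u : Fin m → ℝ) : ℝ≥0∞ :=
  ENNReal.ofReal (dirichletNorm m β) * simplexWeight (fun _ => β / 2) (weights u)

theorem measurable_weights {m : ℕ} : Measurable (weights : (Fin m → ℝ) → Fin (m + 1) → ℝ) := by
  refine measurable_pi_iff.2 fun i => ?_
  refine Fin.lastCases ?_ (fun i => ?_) i
  · simp only [weights_last]; fun_prop
  · simp only [weights_castSucc]; fun_prop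

theorem measurable_dirichletDensity (m : ℕ) (β : ℝ) : Measurable (dirichletDensity m β) :=
  ((measurable_simplexWeight _).comp measurable_weights).const_mul _

theorem dirichletDensity_of_pos {m : ℕ} {β : ℝ} (hβ : 0 < β) {u : Fin m → ℝ}
    (hu : ∀ i, 0 < weights u i) : dirichletDensity m β u
      = ENNReal.ofReal (dirichletNorm m β * ∏ i, weights u i ^ (β / 2 - 1)) := by
  rw [ENNReal.ofReal_mul (dirichletNorm_pos m hβ).le, dirichletDensity, simplexWeight,
    ENNReal.ofReal_prod_of_nonneg fun i _ => (Real.rpow_pos_of_pos (hu i) _).le]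
  congr 1
  exact prod_congr rfl fun i _ => by rw [if_pos (hu i)]

theorem dirichletDensity_of_not_pos {m : ℕ} {β : ℝ} {u : Fin m → ℝ}
    (hu : ¬ ∀ i, 0 < weights u i) : dirichletDensity m β u = 0 := by
  obtain ⟨i, hi⟩ := not_forall.1 hu
  rw [dirichletDensity, simplexWeight, prod_eq_zero (mem_univ i), mul_zero]
  rw [if_neg hi, ENNReal.ofReal_zero]

theorem dirichletMeasure_eq (m : ℕ) {β : ℝ} (hβ : 0 < β) :
    dirichletMeasure (fun _ : Fin (m + 1) => β / 2)
      = (volume.withDensity (dirichletDensity m β)).map weights := by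
  have h1 : (simplexPoint (m + 1) : (Fin m → ℝ) → Fin (m + 1) → ℝ) = weights :=
    funext simplexPoint_eq_weights
  rw [dirichletMeasure]
  change Measure.map (simplexPoint (m + 1)) (volume.withDensity fun x : Fin m → ℝ => _) = _
  rw [h1]
  congr 2
  ext u
  by_cases hu : ∀ i, 0 < weights u i
  · rw [dirichletDensity_of_pos hβ hu, if_pos hu]; rfl
  · rw [dirichletDensity_of_not_pos hu, if_neg hu, ENNReal.ofReal_zero]

theorem isProbabilityMeasure_dirichletDensity (m : ℕ) {β : ℝ} (hβ : 0 < β) :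
    IsProbabilityMeasure (volume.withDensity (dirichletDensity m β)) := by
  constructor
  rw [withDensity_apply _ MeasurableSet.univ, Measure.restrict_univ]
  simp_rw [dirichletDensity]
  have h := lintegral_simplexWeight (m := m) (α := fun _ => β / 2) fun _ => half_pos hβ
  have h2 : 0 < ∏ _i : Fin (m + 1), Real.Gamma (β / 2) :=
    prod_pos fun _ _ => Real.Gamma_pos_of_pos (half_pos hβ)
  rw [lintegral_const_mul' _ _ ENNReal.ofReal_ne_top, dirichletNorm, div_eq_inv_mul,
    ENNReal.ofReal_mul (by positivity), mul_assoc, h, ← ENNReal.ofReal_mul (by positivity),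
    inv_mul_cancel₀ h2.ne', ENNReal.ofReal_one]

/-- The density of the ordered eigenvalues. -/
def chamberDensity (m : ℕ) (β : ℝ) : (Fin (m + 1) → ℝ) → ℝ≥0∞ :=
  {x | StrictAnti x}.indicator fun x => ENNReal.ofReal (chamberNorm m β * gbeWeight (m + 1) β x)

theorem continuous_vandermondeProd (n : ℕ) :
    Continuous (vandermondeProd : (Fin n → ℝ) → ℝ) := by
  unfold vandermondeProd; fun_prop

theorem measurable_gbeWeight (n : ℕ) (β : ℝ) : Measurable (gbeWeight n β) := by
  have := (continuous_vandermondeProd n).measurable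
  unfold gbeWeight; fun_prop

theorem gbeWeight_nonneg (n : ℕ) (β : ℝ) (x : Fin n → ℝ) : 0 ≤ gbeWeight n β x := by
  unfold gbeWeight; positivity

theorem measurable_chamberDensity (m : ℕ) (β : ℝ) : Measurable (chamberDensity m β) :=
  (ENNReal.measurable_ofReal.comp ((measurable_gbeWeight _ _).const_mul _)).indicator
    (measurableSet_strictAnti _)

theorem measurableSet_jacobiDomain (m : ℕ) : MeasurableSet (jacobiDomain m) := by
  simp only [jacobiDomain, Set.ofPred_forall]
  exact MeasurableSet.iInter fun i => measurableSet_lt measurable_const (measurable_pi_apply _)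

theorem measurableSet_spectralDomain (m : ℕ) : MeasurableSet (spectralDomain m) := by
  have h1 : Measurable fun x : Idx m → ℝ => fun i : Fin (m + 1) => x (Sum.inl i) := by fun_prop
  have h2 : Measurable fun x : Idx m → ℝ => weights fun i => x (Sum.inr i) :=
    measurable_weights.comp (by fun_prop)
  have h3 : MeasurableSet {x : Idx m → ℝ | ∀ i, 0 < weights (fun i => x (Sum.inr i)) i} := by
    simp only [Set.ofPred_forall]
    exact MeasurableSet.iInter fun i => measurableSet_lt measurable_const
      ((measurable_pi_apply i).comp h2)
  exact (h1 (measurableSet_strictAnti _)).inter h3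

theorem det_toLin'_toContinuousLinearMap {ι : Type*} [Fintype ι] [DecidableEq ι]
    (J : Matrix ι ι ℝ) : (LinearMap.toContinuousLinearMap (Matrix.toLin' J)).det = J.det := by
  rw [ContinuousLinearMap.det]
  exact LinearMap.det_toLin' J

theorem pi_paramLaw_eq {m : ℕ} {β : ℝ} (hβ : 0 < β) :
    Measure.pi (paramLaw (m := m) β) = (volume.restrict (jacobiDomain m)).withDensity
      fun y => ENNReal.ofReal (∏ j, paramPDF β j (y j)) := by
  have hp := isProbabilityMeasure_paramLaw (m := m) hβ
  have : ∀ j : Idx m, SigmaFinite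
      (volume.withDensity fun t => ENNReal.ofReal (paramPDF β j t)) := fun j =>
    have := hp j
    inferInstanceAs (SigmaFinite (paramLaw β j))
  rw [← withDensity_indicator (measurableSet_jacobiDomain m)]
  refine (pi_withDensity fun j => (measurable_paramPDF β j).ennreal_ofReal).trans ?_
  congr 1
  ext y
  rw [← ENNReal.ofReal_prod_of_nonneg fun j _ => paramPDF_nonneg hβ j _]
  by_cases hy : y ∈ jacobiDomain m
  · rw [Set.indicator_of_mem hy]
  · rw [Set.indicator_of_notMem hy]
    obtain ⟨k, hk⟩ := not_forall.1 hy
    rw [prod_eq_zero (mem_univ (Sum.inr k)), ENNReal.ofReal_zero]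
    simp [paramPDF, chiPDF, if_neg hk]

theorem ae_mem_jacobiDomain {m : ℕ} {β : ℝ} (hβ : 0 < β) :
    ∀ᵐ y ∂Measure.pi (paramLaw (m := m) β), y ∈ jacobiDomain m := by
  rw [pi_paramLaw_eq hβ]
  exact (withDensity_absolutelyContinuous _ _).ae_le
    (ae_restrict_mem (measurableSet_jacobiDomain m))

/-- The spectral domain is a chamber times a simplex and the density factors accordingly; this is
where independence appears. -/
theorem withDensity_spectralDomain_map {m : ℕ} {β : ℝ} :
    ((volume.restrict (spectralDomain m)).withDensity fun x =>
      ENNReal.ofReal (chamberNorm m β * gbeWeight (m + 1) β fun i => x (Sum.inl i)) *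
        dirichletDensity m β fun i => x (Sum.inr i)).map
          (MeasurableEquiv.sumPiEquivProdPi fun _ : Idx m => ℝ)
      = (volume.withDensity (chamberDensity m β)).prod
          (volume.withDensity (dirichletDensity m β)) := by
  have hg : Measurable fun z : (Fin (m + 1) → ℝ) × (Fin m → ℝ) =>
      chamberDensity m β z.1 * dirichletDensity m β z.2 :=
    ((measurable_chamberDensity m β).comp measurable_fst).mul
      ((measurable_dirichletDensity m β).comp measurable_snd)
  rw [← withDensity_indicator (measurableSet_spectralDomain m),
    prod_withDensity (measurable_chamberDensity m β) (measurable_dirichletDensity m β)]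
  ext S hS
  rw [MeasurableEquiv.map_apply, withDensity_apply _ hS,
    withDensity_apply _ ((MeasurableEquiv.measurable _) hS), ← Measure.volume_eq_prod,
    ← (volume_measurePreserving_sumPiEquivProdPi fun _ : Idx m => ℝ).setLIntegral_comp_preimage
      hS hg]
  refine lintegral_congr fun x => ?_
  change _ = chamberDensity m β (fun i => x (Sum.inl i)) *
    dirichletDensity m β fun i => x (Sum.inr i)
  by_cases h1 : StrictAnti fun i => x (Sum.inl i)
  · rw [show chamberDensity m β (fun i => x (Sum.inl i)) = _ from Set.indicator_of_mem h1 _]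
    by_cases h2 : ∀ i, 0 < weights (fun i => x (Sum.inr i)) i
    · exact Set.indicator_of_mem (s := spectralDomain m) ⟨h1, h2⟩ _
    · rw [dirichletDensity_of_not_pos h2, mul_zero]
      exact Set.indicator_of_notMem (s := spectralDomain m) (fun h => h2 h.2) _
  · rw [show chamberDensity m β (fun i => x (Sum.inl i)) = 0 from Set.indicator_of_notMem h1 _,
      zero_mul]
    exact Set.indicator_of_notMem (s := spectralDomain m) (fun h => h1 h.1) _

/-- A map assigning to a Jacobi matrix its spectral data has the expected law. -/
theorem hasLaw_of_atomicMoment_eq {m : ℕ} {β : ℝ} (hβ : 0 < β) {Φ : (Idx m → ℝ) → Idx m → ℝ}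
    (hΦ : ∀ y ∈ jacobiDomain m, Φ y ∈ spectralDomain m ∧ atomicMoment (Φ y) = jacobiMoment y) :
    HasLaw (fun y => MeasurableEquiv.sumPiEquivProdPi (fun _ : Idx m => ℝ) (Φ y))
      ((volume.withDensity (chamberDensity m β)).prod
        (volume.withDensity (dirichletDensity m β))) (Measure.pi (paramLaw (m := m) β)) := by
  have hm : Measurable (jacobiMoment (m := m)) :=
    measurable_pi_iff.2 fun j => (differentiable_jacobiMoment j).continuous.measurable
  have hdetpos : ∀ y ∈ jacobiDomain m, (jacobiJacobian y).det ≠ 0 := by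
    intro y hy
    rw [det_jacobiJacobian]
    exact (mul_pos (prod_pos fun k _ => pow_pos (offProd_pos hy _) 2)
      (prod_pos fun k _ => mul_pos (pow_pos (offProd_pos hy _) 2) (hy k))).ne'
  have key := map_withDensity_of_image_eq (E := Idx m → ℝ) volume (measurableSet_spectralDomain m)
    (measurableSet_jacobiDomain m) (fun x _ => (hasFDerivAt_atomicMoment x).hasFDerivWithinAt)
    (fun y _ => (hasFDerivAt_jacobiMoment y).hasFDerivWithinAt) hm (injOn_atomicMoment m)
    (injOn_jacobiMoment m) (image_atomicMoment_eq m)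
    (fun y hy => by rw [det_toLin'_toContinuousLinearMap]; exact hdetpos y hy)
    (σ := fun y => ENNReal.ofReal (∏ j, paramPDF β j (y j)))
    (ρ := fun x => ENNReal.ofReal (chamberNorm m β * gbeWeight (m + 1) β fun i => x (Sum.inl i)) *
        dirichletDensity m β fun i => x (Sum.inr i))
    (fun x hx y hy hxy => by
      have hc : 0 ≤ chamberNorm m β * gbeWeight (m + 1) β fun i => x (Sum.inl i) :=
        mul_nonneg (chamberNorm_pos m hβ).le (gbeWeight_nonneg _ _ _)
      have hd : 0 ≤ dirichletNorm m β * ∏ i, weights (fun i => x (Sum.inr i)) i ^ (β / 2 - 1) :=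
        mul_nonneg (dirichletNorm_pos m hβ).le
          (prod_nonneg fun i _ => (Real.rpow_pos_of_pos (hx.2 i) _).le)
      rw [det_toLin'_toContinuousLinearMap, det_toLin'_toContinuousLinearMap,
        dirichletDensity_of_pos hβ hx.2, ← ENNReal.ofReal_mul
          (prod_nonneg fun j _ => paramPDF_nonneg hβ j _), ← ENNReal.ofReal_mul hc,
        ← ENNReal.ofReal_mul (mul_nonneg hc hd), density_relation hβ hx hy hxy])
    hΦ
  have h1 : HasLaw Φ ((volume.restrict (spectralDomain m)).withDensity fun x =>
      ENNReal.ofReal (chamberNorm m β * gbeWeight (m + 1) β fun i => x (Sum.inl i)) *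
        dirichletDensity m β fun i => x (Sum.inr i)) (Measure.pi (paramLaw (m := m) β)) :=
    ⟨by rw [pi_paramLaw_eq hβ]; exact key.1.mono_ac (withDensity_absolutelyContinuous _ _),
      by rw [pi_paramLaw_eq hβ]; exact key.2⟩
  exact HasLaw.fun_comp ⟨(MeasurableEquiv.measurable _).aemeasurable,
    withDensity_spectralDomain_map⟩ h1

/-- Some choice of ordered atoms and weights for every Jacobi matrix. -/
theorem exists_spectralMap (m : ℕ) : ∃ Φ : (Idx m → ℝ) → Idx m → ℝ, ∀ y ∈ jacobiDomain m,
    Φ y ∈ spectralDomain m ∧ atomicMoment (Φ y) = jacobiMoment y := by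
  have h : ∀ y : Idx m → ℝ, ∃ x, y ∈ jacobiDomain m →
      x ∈ spectralDomain m ∧ atomicMoment x = jacobiMoment y := by
    intro y
    by_cases hy : y ∈ jacobiDomain m
    · obtain ⟨x, hx, hxy⟩ : jacobiMoment y ∈ atomicMoment '' spectralDomain m :=
        image_atomicMoment_eq m ▸ Set.mem_image_of_mem _ hy
      exact ⟨x, fun _ => ⟨hx, hxy⟩⟩
    · exact ⟨0, fun h => absurd h hy⟩
  choose Φ hΦ using h
  exact ⟨Φ, hΦ⟩

/-- The product is the image of a probability law and its Dirichlet factor has mass one, so the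
other factor does too. This fixes the constant of the ensemble. -/
theorem isProbabilityMeasure_chamberDensity (m : ℕ) {β : ℝ} (hβ : 0 < β) :
    IsProbabilityMeasure (volume.withDensity (chamberDensity m β)) := by
  obtain ⟨Φ, hΦ⟩ := exists_spectralMap m
  have hp := isProbabilityMeasure_paramLaw (m := m) hβ
  have hd := isProbabilityMeasure_dirichletDensity m hβ
  have h := (hasLaw_of_atomicMoment_eq hβ hΦ).isProbabilityMeasure_iff.1 inferInstance
  have h1 := h.measure_univ
  rw [← Set.univ_prod_univ, Measure.prod_prod, hd.measure_univ, mul_one] at h1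
  exact ⟨h1⟩

/-! ### Normalization of the Gaussian beta-ensemble -/

theorem gbeWeight_comp_perm {n : ℕ} (β : ℝ) (s : Equiv.Perm (Fin n)) (x : Fin n → ℝ) :
    gbeWeight n β (x ∘ s) = gbeWeight n β x := by
  have h1 : Matrix.vandermonde (x ∘ s) = (Matrix.vandermonde x).submatrix s (Equiv.refl _) := by
    ext i j; simp [Matrix.vandermonde_apply]
  rw [gbeWeight, gbeWeight, vandermondeProd_sq_eq_det, vandermondeProd_sq_eq_det, h1,
    Matrix.abs_det_submatrix_equiv_equiv]
  congr 3
  exact Equiv.sum_comp s fun i => x i ^ 2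

/-- Symmetrization for measures with a symmetric density. -/
theorem withDensity_eq_factorial_mul {n : ℕ} {f : (Fin n → ℝ) → ℝ≥0∞} (hf : Measurable f)
    (hs : ∀ (s : Equiv.Perm (Fin n)) x, f (x ∘ s) = f x) {A : Set (Fin n → ℝ)}
    (hA : MeasurableSet A)
    (hinv : ∀ (s : Equiv.Perm (Fin n)) (x : Fin n → ℝ), x ∈ A → x ∘ s ∈ A) :
    volume.withDensity f A = n.factorial * volume.withDensity f (A ∩ {x | StrictAnti x}) := by
  refine measure_eq_factorial_mul (fun s => ⟨(measurePreserving_comp_perm s).measurable, ?_⟩)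
    (fun i j hij => withDensity_absolutelyContinuous _ _ (volume_tie hij)) hA hinv
  ext S hS
  have hm := (measurePreserving_comp_perm s).measurable
  rw [Measure.map_apply hm hS, withDensity_apply _ hS, withDensity_apply _ (hm hS),
    ← (measurePreserving_comp_perm s).setLIntegral_comp_preimage hS hf]
  simp_rw [hs]

/-- The weight is symmetric, so the integral is `(m + 1)!` times that over the chamber, which is
known from the previous normalization. -/
theorem lintegral_gbeWeight (m : ℕ) {β : ℝ} (hβ : 0 < β) :
    ∫⁻ x, ENNReal.ofReal (gbeWeight (m + 1) β x)
      = ENNReal.ofReal ((m + 1).factorial / chamberNorm m β) := by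
  have h1 := (isProbabilityMeasure_chamberDensity m hβ).measure_univ
  have hC := chamberNorm_pos m hβ
  have hmeas := (measurable_gbeWeight (m + 1) β).ennreal_ofReal
  rw [withDensity_apply _ MeasurableSet.univ, Measure.restrict_univ, chamberDensity,
    lintegral_indicator (measurableSet_strictAnti _)] at h1
  simp_rw [ENNReal.ofReal_mul hC.le] at h1
  rw [lintegral_const_mul' _ _ ENNReal.ofReal_ne_top,
    ← withDensity_apply _ (measurableSet_strictAnti _)] at h1
  have h2 := withDensity_eq_factorial_mul hmeas (fun s x => by rw [gbeWeight_comp_perm])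
    MeasurableSet.univ fun _ _ _ => trivial
  rw [Set.univ_inter, withDensity_apply _ MeasurableSet.univ, Measure.restrict_univ] at h2
  have h3 := ENNReal.eq_inv_of_mul_eq_one_left ((mul_comm _ _).trans h1)
  rw [h2, h3, ENNReal.ofReal_div_of_pos hC, ENNReal.ofReal_natCast, div_eq_mul_inv]

theorem integrable_gbeWeight (m : ℕ) {β : ℝ} (hβ : 0 < β) : Integrable (gbeWeight (m + 1) β) := by
  refine ⟨(measurable_gbeWeight _ _).aestronglyMeasurable, ?_⟩
  rw [hasFiniteIntegral_iff_ofReal (ae_of_all _ (gbeWeight_nonneg _ _)), lintegral_gbeWeight m hβ]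
  exact ENNReal.ofReal_lt_top

theorem gbeConst_eq (m : ℕ) {β : ℝ} (hβ : 0 < β) :
    gbeConst (m + 1) β = (m + 1).factorial / chamberNorm m β := by
  have hC := chamberNorm_pos m hβ
  rw [gbeConst, integral_eq_lintegral_of_nonneg_ae (ae_of_all _ (gbeWeight_nonneg _ _))
    (measurable_gbeWeight _ _).aestronglyMeasurable, lintegral_gbeWeight m hβ,
    ENNReal.toReal_ofReal (by positivity)]

theorem orderedGbe_eq (m : ℕ) {β : ℝ} (hβ : 0 < β) :
    orderedGbe (m + 1) β = volume.withDensity (chamberDensity m β) := by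
  have hC := chamberNorm_pos m hβ
  have hf : (0 : ℝ) < (m + 1).factorial := by positivity
  have hmeas : Measurable fun x => ENNReal.ofReal (gbeWeight (m + 1) β x / gbeConst (m + 1) β) :=
    ((measurable_gbeWeight (m + 1) β).div_const _).ennreal_ofReal
  rw [orderedGbe, gbe, restrict_withDensity (measurableSet_strictAnti _), chamberDensity,
    withDensity_indicator (measurableSet_strictAnti _), ← withDensity_smul _ hmeas]
  congr 1
  ext x
  rw [Pi.smul_apply, smul_eq_mul, gbeConst_eq m hβ, ← ENNReal.ofReal_natCast,
    ← ENNReal.ofReal_mul hf.le]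
  congr 1
  field_simp

theorem orderedGbe_apply {n : ℕ} (β : ℝ) {A : Set (Fin n → ℝ)} (hA : MeasurableSet A)
    (hinv : ∀ (s : Equiv.Perm (Fin n)) (x : Fin n → ℝ), x ∈ A → x ∘ s ∈ A) :
    orderedGbe n β A = gbe n β A := by
  rw [orderedGbe, Measure.smul_apply, Measure.restrict_apply hA, smul_eq_mul]
  exact (withDensity_eq_factorial_mul ((measurable_gbeWeight n β).div_const _).ennreal_ofReal
    (fun s x => by rw [gbeWeight_comp_perm]) hA hinv).symm

/-! ### The spectral data of the tridiagonal model -/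

section Model

variable {m : ℕ} {β : ℝ} {Ω : Type*} [MeasurableSpace Ω] {P : Measure Ω}
  {N : Fin (m + 1) → Ω → ℝ} {χ : Fin m → Ω → ℝ}
  {Q : Ω → Matrix (Fin (m + 1)) (Fin (m + 1)) ℝ} {eig : Ω → Fin (m + 1) → ℝ}

theorem hasLaw_params (hN : ∀ i, HasLaw (N i) (gaussianReal 0 1) P)
    (hχ : ∀ i, HasLaw (χ i) (chiMeasure (chiDof m β i)) P) (hind : iIndepFun (Sum.elim N χ) P) :
    HasLaw (fun ω (j : Idx m) => Sum.elim N χ j ω) (Measure.pi (paramLaw β)) P := by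
  refine hind.hasLaw_pi fun j => ?_
  rcases j with k | k
  · rw [paramLaw_inl]; exact hN k
  · rw [paramLaw_inr]; exact hχ k

/-- The joint law of the ordered eigenvalues and the squared first components of the normalized
eigenvectors. -/
theorem hasLaw_eig_weights (hβ : 0 < β) (hN : ∀ i, HasLaw (N i) (gaussianReal 0 1) P)
    (hχ : ∀ i, HasLaw (χ i) (chiMeasure (chiDof m β i)) P) (hind : iIndepFun (Sum.elim N χ) P)
    (hdiag : ∀ᵐ ω ∂P, IsOrderedDiagonalization
      (jacobiMatrix (n := m + 1) (fun i => N i ω) (fun i => χ i ω / √2)) (Q ω) (eig ω)) :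
    HasLaw (fun ω => (eig ω, fun k => Q ω 0 k ^ 2))
      ((orderedGbe (m + 1) β).prod (dirichletMeasure fun _ : Fin (m + 1) => β / 2)) P := by
  obtain ⟨Φ, hΦ⟩ := exists_spectralMap m
  have hd := isProbabilityMeasure_dirichletDensity m hβ
  have hc := isProbabilityMeasure_chamberDensity m hβ
  have hy := hasLaw_params hN hχ hind
  have h1 := (hasLaw_of_atomicMoment_eq hβ hΦ).comp hy
  have hmap : HasLaw (Prod.map id weights)
      ((orderedGbe (m + 1) β).prod (dirichletMeasure fun _ : Fin (m + 1) => β / 2))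
      ((volume.withDensity (chamberDensity m β)).prod
        (volume.withDensity (dirichletDensity m β))) := by
    refine ⟨(measurable_id.prodMap measurable_weights).aemeasurable, ?_⟩
    rw [orderedGbe_eq m hβ, dirichletMeasure_eq m hβ,
      ← Measure.map_prod_map _ _ measurable_id measurable_weights, Measure.map_id]
  -- `Q` and `eig` need not be measurable: almost surely their spectral data coincide with the
  -- chosen `Φ` by injectivity of the moments, and this transfers the law.
  refine (hmap.comp h1).congr ?_
  have hmem : ∀ᵐ ω ∂P, (fun j => Sum.elim N χ j ω) ∈ jacobiDomain m := by
    have := ae_mem_jacobiDomain (m := m) hβ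
    rw [← hy.map_eq] at this
    exact ae_of_ae_map hy.aemeasurable this
  filter_upwards [hmem, hdiag] with ω hω hdω
  obtain ⟨hX, hXY⟩ := hΦ _ hω
  have hdω' : IsOrderedDiagonalization (jac fun j => Sum.elim N χ j ω) (Q ω) (eig ω) := hdω
  have h2 : Φ (fun j => Sum.elim N χ j ω) = spectralData (Q ω) (eig ω) :=
    injOn_atomicMoment m hX (spectralData_mem hω hdω')
      (hXY.trans (atomicMoment_spectralData hdω').symm)
  simp only [Function.comp_apply, h2]
  refine Prod.ext rfl ?_
  exact (weights_spectralData (l := eig ω) hdω.2.1).symm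

end Model

end BetaEnsemble

end

theorem theorem1p1 (n : ℕ) (hn : 0 < n) (β : ℝ) (hβ : 0 < β) :
    -- the Macdonald-Mehta-Opdam formula
    (Integrable (gbeWeight n β) ∧
      gbeConst n β = (2 * Real.pi) ^ ((n : ℝ) / 2) *
        ∏ j ∈ Finset.Icc 1 n, Real.Gamma (1 + β / 2 * (j : ℝ)) / Real.Gamma (1 + β / 2)) ∧
    -- the spectral data of the tridiagonal model
    (∀ (Ω : Type*) [MeasurableSpace Ω] (P : Measure Ω) [IsProbabilityMeasure P]
      (N : Fin n → Ω → ℝ) (χ : Fin (n - 1) → Ω → ℝ)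
      (Q : Ω → Matrix (Fin n) (Fin n) ℝ) (eig : Ω → Fin n → ℝ),
      (∀ i, HasLaw (N i) (gaussianReal 0 1) P) →
      (∀ i, HasLaw (χ i) (chiMeasure (((n : ℝ) - ((i : ℕ) + 1 : ℝ)) * β)) P) →
      iIndepFun (Sum.elim N χ) P →
      (∀ᵐ ω ∂P, IsOrderedDiagonalization
        (jacobiMatrix (fun i => N i ω) (fun i => χ i ω / √2)) (Q ω) (eig ω)) →
      -- as an unordered configuration, the spectrum is the Gaussian beta-ensemble
      (∀ A : Set (Fin n → ℝ), MeasurableSet A →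
        (∀ (s : Equiv.Perm (Fin n)) (x : Fin n → ℝ), x ∈ A → x ∘ s ∈ A) →
        P {ω | eig ω ∈ A} = gbe n β A) ∧
      -- law of the ordered eigenvalues
      HasLaw eig (orderedGbe n β) P ∧
      -- law of the squared first components of the normalized eigenvectors
      HasLaw (fun ω k => Q ω ⟨0, hn⟩ k ^ 2) (dirichletMeasure fun _ : Fin n => β / 2) P ∧
      IndepFun eig (fun ω k => Q ω ⟨0, hn⟩ k ^ 2) P) := by
  -- After this substitution `Fin (n - 1)` is definitionally `Fin m`, and the chi parameter in the
  -- statement is `chiDof m β i`.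
  obtain ⟨m, rfl⟩ : ∃ m, n = m + 1 := ⟨n - 1, by omega⟩
  refine ⟨⟨integrable_gbeWeight m hβ, ?_⟩, ?_⟩
  · rw [gbeConst_eq m hβ, factorial_div_chamberNorm m hβ]
  intro Ω _ P _ N χ Q eig hN hχ hind hdiag
  have hlaw := hasLaw_eig_weights (m := m) hβ hN hχ hind hdiag
  have hd := isProbabilityMeasure_dirichletDensity m hβ
  have hc := isProbabilityMeasure_chamberDensity m hβ
  have hD : IsProbabilityMeasure (dirichletMeasure fun _ : Fin (m + 1) => β / 2) := by
    rw [dirichletMeasure_eq m hβ]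
    exact Measure.isProbabilityMeasure_map measurable_weights.aemeasurable
  have hO : IsProbabilityMeasure (orderedGbe (m + 1) β) := by rwa [orderedGbe_eq m hβ]
  have heig : HasLaw eig (orderedGbe (m + 1) β) P :=
    measurePreserving_fst.fun_comp_hasLaw hlaw
  have hw : HasLaw (fun ω k => Q ω ⟨0, hn⟩ k ^ 2)
      (dirichletMeasure fun _ : Fin (m + 1) => β / 2) P :=
    measurePreserving_snd.fun_comp_hasLaw hlaw
  refine ⟨fun A hA hinv => ?_, heig, hw, (indepFun_iff_hasLaw_prodMk_prod heig hw).2 hlaw⟩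
  rw [← orderedGbe_apply β hA hinv]
  exact heig.measure_eq hA
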